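/- Let $d\ge 1$ be an integer and let $\tilde I=[a,b]$ with $a<b$. For a curve $\gamma\colon\tilde I\to\mathbb R^d$, a permutation $\sigma\in S_d$ and $1\le j\le d$ put $$L^{\gamma}_{\sigma,j}(t)=\det\big(\gamma_{\sigma(p)}^{(q)}(t)\big)_{1\le p,q\le j},\qquad L^\gamma_d=L^\gamma_{\mathrm{id},d}.$$ For $m\ge 1$ and $h\in\mathbb R^m$ let $\gamma_h(t)=\frac1m\sum_{p=1}^m\gamma(t+h_p)$ be the offspring curve, with derivatives $\gamma_h^{(q)}(t)=\frac1m\sum_{p}\gamma^{(q)}(t+h_p)$. For $I\subseteq\tilde I$ let $I_h=\{t: t+h_p\in I \text{ for all } p\}$ (so $[\alpha,\beta]_h=[\alpha-h_1,\beta-h_m]$ when $h_1\le\dots\le h_m$). For real $N$, $C^N$ means $C^{\lfloor N\rfloor,\,N-\lfloor N\rfloor}$. Put $\|\gamma\|_{C^d}=\sup_{0\le i\le d,\,t\in\tilde I}|\gamma^{(i)}(t)|$ and $x_+=\max(x,0)$. There are constants $c_1,c_2,C>0$ depending only on $d$ and $\tilde I$; for every curve $\gamma$, constants $C_\gamma>0$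 and $A_1,\dots,A_d\in\mathbb R$ depending only on $d,\tilde I,\gamma$; and for every real $N>d$ with $\gamma\in C^N(\tilde I;\mathbb R^d)$, a constant $C_{N,\gamma}>0$ depending only on $d,\tilde I,\gamma,N$, such that for every $k_d\in\mathbb Z$ the following two statements hold for the set $$E=\{t\in\tilde I: 2^{-k_d-1}\le|L^\gamma_d(t)|\le 2^{-k_d}\}.$$ (1) (Initial decomposition.) There are finitely many compact intervals $I_l\subseteq\tilde I$, permutations $\sigma_l\in S_d$ and integers $k_{l,j}$ ($1\le j\le d$), with $k_{l,d}=k_d$, such that $E\subseteq\bigcup_l I_l$, $$A_j\le k_{l,j}\le k_d+A_j+\log_2\!\big(d!\,\|\gamma\|_{C^d}^d\big)+2,$$ $$2^{-k_{l,j}-2}\le|L^\gamma_{\sigma_l,j}(t)|\le 2^{-k_{l,j}+1}\qquad\text{for all } t\in I_l,\ 1\le j\le d,$$ $$\#\{I_l\}\le C_{N,\gamma}\,2^{k_d\sum_{j=1}^d\frac1{N-j}},\qquad \sum_l|I_l|\le C\,(k_d+C_\gamma)_+^d .$$ (2) (Full decomposition.) There are finitely many compact intervals $I_l\subseteq\tilde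 I$, permutations $\sigma_l\in S_d$ and integers $k_{l,j}$ ($1\le j\le d$), with $k_{l,d}=k_d$, such that $E\subseteq\bigcup_l I_l$, and for every $m\ge1$ and $h\in\mathbb R^m$, $$c_1\,2^{-k_{l,j}}\le|L^{\gamma_h}_{\sigma_l,j}(t)|\le c_2\,2^{-k_{l,j}}\qquad\text{for all } t\in (I_l)_h,\ 1\le j\le d,$$ $$\#\{I_l\}\le C_{N,\gamma}\,(k_d+C_\gamma)_+^d\,2^{k_d\sum_{j=1}^d\frac1{N-j}},\qquad \sum_l|I_l|\le C\,(k_d+C_\gamma)_+^d .$$ (If $E$ is empty, in particular if $\|\gamma\|_{C^d}=0$, the families may be empty.) -/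

import Mathlib

noncomputable section

namespace TorsionDecomposition

open Set

/-- `γ ∈ C^N([a,b]; ℝ^d)` for a real exponent `N ≥ 0`, in the sense `C^{⌊N⌋, N - ⌊N⌋}`: the curve is
`⌊N⌋` times continuously differentiable on `[a,b]` (one-sidedly at the endpoints) and its derivative
of order `⌊N⌋` is Hölder continuous of exponent `N - ⌊N⌋` on `[a,b]`. For an integer `N` the second
condition has exponent `0` and only says that this derivative is bounded in oscillation, which is
automatic. -/
def IsCurveOfClass {d : ℕ} (N : ℝ) (a b : ℝ) (γ : ℝ → EuclideanSpace ℝ (Fin d)) : Prop :=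
  ContDiffOn ℝ (⌊N⌋₊ : ℕ) γ (Icc a b) ∧
    ∃ K : NNReal,
      HolderOnWith K (N - ⌊N⌋₊).toNNReal (iteratedDerivWithin ⌊N⌋₊ γ (Icc a b)) (Icc a b)

/-- The derivative `γ^{(i)}(t)` of a curve defined on `[a,b]`. -/
def curveDeriv {d : ℕ} (a b : ℝ) (γ : ℝ → EuclideanSpace ℝ (Fin d)) (i : ℕ) (t : ℝ) :
    EuclideanSpace ℝ (Fin d) :=
  iteratedDerivWithin i γ (Icc a b) t

/-- The norm `‖γ‖_{C^d}` on `[a,b]`: the supremum of `‖γ^{(i)}(t)‖` over `0 ≤ i ≤ d`, `t ∈ [a,b]`. -/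
def curveNorm {d : ℕ} (a b : ℝ) (γ : ℝ → EuclideanSpace ℝ (Fin d)) : ℝ :=
  sSup {x : ℝ | ∃ i : ℕ, i ≤ d ∧ ∃ t ∈ Icc a b, x = ‖curveDeriv a b γ i t‖}

/-- The determinant of the `j × j` matrix whose entry in row `p`, column `q` (`1 ≤ p, q ≤ j`) is
the `σ(p)`-th coordinate of `D q`. With `D q = ζ^{(q)}(t)` this is the torsion minor
`L_{σ,j}^ζ(t)`. -/
def torsionMinor {d : ℕ} (D : ℕ → EuclideanSpace ℝ (Fin d)) (σ : Equiv.Perm (Fin d))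
    (j : ℕ) (hj : j ≤ d) : ℝ :=
  Matrix.det (Matrix.of fun p q : Fin j => D ((q : ℕ) + 1) (σ (Fin.castLE hj p)))

/-- The minor `L_{σ,j}^γ(t)` of a curve on `[a,b]`. -/
def curveMinor {d : ℕ} (a b : ℝ) (γ : ℝ → EuclideanSpace ℝ (Fin d)) (σ : Equiv.Perm (Fin d))
    (j : ℕ) (hj : j ≤ d) (t : ℝ) : ℝ :=
  torsionMinor (fun i => curveDeriv a b γ i t) σ j hj

/-- For `h ∈ ℝ^m` and a set `I`, the set `I_h` of all `t` such that `t + h_1, …, t + h_m` lie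
in `I`. -/
def shifted {m : ℕ} (I : Set ℝ) (h : Fin m → ℝ) : Set ℝ :=
  {t | ∀ p, t + h p ∈ I}

/-- For an ordered `h`, the set `[a,b]_h` is the interval `[a - h_1, b - h_m]`. -/
theorem shifted_Icc {m : ℕ} (a b : ℝ) (h : Fin (m + 1) → ℝ) (hh : Monotone h) :
    shifted (Icc a b) h = Icc (a - h 0) (b - h (Fin.last m)) := by
  ext t
  simp only [shifted, mem_ofPred_eq, mem_Icc]
  constructor
  · intro H
    have h0 := (H 0).1
    have h1 := (H (Fin.last m)).2
    exact ⟨by linarith, by linarith⟩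
  · rintro ⟨h0, h1⟩ p
    have h2 := hh (Fin.zero_le p)
    have h3 := hh (Fin.le_last p)
    exact ⟨by linarith, by linarith⟩

/-- The offspring curve `γ_h(t) = (1/m) ∑ γ(t + h_p)`. -/
def offspring {d m : ℕ} (γ : ℝ → EuclideanSpace ℝ (Fin d)) (h : Fin m → ℝ) (t : ℝ) :
    EuclideanSpace ℝ (Fin d) :=
  (m : ℝ)⁻¹ • ∑ p, γ (t + h p)

/-- The derivative of order `i` of the offspring curve `γ_h` of a curve `γ` on `[a,b]`, that is
`γ_h^{(i)}(t) = (1/m) ∑ γ^{(i)}(t + h_p)`. By `iteratedDerivWithin_offspring` it is the derivative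
of `γ_h` on its domain `[a,b]_h`, whenever the latter has more than one point. -/
def offspringDeriv {d m : ℕ} (a b : ℝ) (γ : ℝ → EuclideanSpace ℝ (Fin d)) (h : Fin m → ℝ)
    (i : ℕ) (t : ℝ) : EuclideanSpace ℝ (Fin d) :=
  offspring (curveDeriv a b γ i) h t

/-- The minor `L_{σ,j}^{γ_h}(t)` of the offspring curve `γ_h`. -/
def offspringMinor {d m : ℕ} (a b : ℝ) (γ : ℝ → EuclideanSpace ℝ (Fin d)) (h : Fin m → ℝ)
    (σ : Equiv.Perm (Fin d)) (j : ℕ) (hj : j ≤ d) (t : ℝ) : ℝ :=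
  torsionMinor (fun i => offspringDeriv a b γ h i t) σ j hj

theorem iteratedDerivWithin_offspring {d m : ℕ} {a b : ℝ} (hab : a < b)
    (γ : ℝ → EuclideanSpace ℝ (Fin d)) (h : Fin m → ℝ)
    (hS : (shifted (Icc a b) h).Nontrivial) (i : ℕ) (hγ : ContDiffOn ℝ i γ (Icc a b))
    (t : ℝ) (ht : t ∈ shifted (Icc a b) h) :
    iteratedDerivWithin i (offspring γ h) (shifted (Icc a b) h) t
      = offspringDeriv a b γ h i t := by
  have hconv : Convex ℝ (shifted (Icc a b) h) := by
    rw [convex_iff_ordConnected]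
    refine ⟨fun x hx y hy z hz p => ?_⟩
    have h1 := hx p
    have h2 := hy p
    simp only [mem_Icc] at h1 h2 hz ⊢
    exact ⟨by linarith, by linarith⟩
  have hint : (interior (shifted (Icc a b) h)).Nonempty :=
    hconv.nontrivial_iff_nonempty_interior.1 hS
  have hud : UniqueDiffOn ℝ (shifted (Icc a b) h) := uniqueDiffOn_convex hconv hint
  induction i generalizing t with
  | zero => simp [offspringDeriv, offspring, curveDeriv]
  | succ i ih =>
    have hγ' : ContDiffOn ℝ i γ (Icc a b) := hγ.of_le (by exact_mod_cast Nat.le_succ i)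
    rw [iteratedDerivWithin_succ, derivWithin_congr (fun s hs => ih hγ' s hs) (ih hγ' t ht)]
    refine HasDerivWithinAt.derivWithin ?_ (hud t ht)
    unfold offspringDeriv offspring
    have key : ∀ p ∈ (Finset.univ : Finset (Fin m)),
        HasDerivWithinAt (fun s => curveDeriv a b γ i (s + h p))
          (curveDeriv a b γ (i + 1) (t + h p)) (shifted (Icc a b) h) t := by
      intro p _
      have hd : DifferentiableWithinAt ℝ (iteratedDerivWithin i γ (Icc a b)) (Icc a b)
          (t + h p) :=
        hγ.differentiableOn_iteratedDerivWithin (by exact_mod_cast Nat.lt_succ_self i)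
          (uniqueDiffOn_Icc hab) _ (ht p)
      have h1 := hd.hasDerivWithinAt
      rw [← iteratedDerivWithin_succ] at h1
      have h2 : HasDerivWithinAt (fun s : ℝ => s + h p) 1 (shifted (Icc a b) h) t :=
        (hasDerivWithinAt_id t _).add_const _
      have h3 := HasDerivWithinAt.scomp (g₁ := iteratedDerivWithin i γ (Icc a b))
        (h := fun s : ℝ => s + h p) t h1 h2 (fun s hs => hs p)
      simpa [curveDeriv, Function.comp_def] using h3
    exact (HasDerivWithinAt.fun_sum key).fun_const_smul ((m : ℝ)⁻¹)

/-- The set of all `t ∈ [a,b]` with `2^{-k-1} ≤ |L_d^γ(t)| ≤ 2^{-k}`. -/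
def torsionLevel {d : ℕ} (a b : ℝ) (γ : ℝ → EuclideanSpace ℝ (Fin d)) (k : ℤ) : Set ℝ :=
  {t ∈ Icc a b | (2 : ℝ) ^ (-k - 1) ≤ |curveMinor a b γ 1 d le_rfl t| ∧
    |curveMinor a b γ 1 d le_rfl t| ≤ (2 : ℝ) ^ (-k)}

/-- The exponent `∑_{j=1}^d 1/(N-j)`. -/
def decompositionExponent (d : ℕ) (N : ℝ) : ℝ :=
  ∑ j ∈ Finset.Icc 1 d, 1 / (N - j)

end TorsionDecomposition

end

noncomputable section

namespace TorsionDecomposition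

/-! ### Bounds for determinants and for polynomial coefficients -/

open Polynomial

/-! The whole argument is about mixed minors, in which each row, a derivative of its own order, is
evaluated at its own point. By multilinearity a minor of the offspring curve is the average of such
mixed minors (`vectorMinor_average`). It therefore suffices to cover $E$ by intervals on which every
mixed minor stays within a quarter of the ordinary minor at one point of $E$ (`IsStable`). The same
intervals then serve both statements, and since they come from a partition of $[a,b]$, their total
length is at most $b-a$.

At a point of $E$ the permutation is found by repeated Laplace expansion, keeping the largest
cofactor each time. All leading minors are then at least a constant times $2^{-k_d}$
(`exists_perm_abs_det_le`, `exists_perm_torsionMinor`).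

To make intervals stable, cut $[a,b]$ into about $2^{k_d/(N-d)}$ pieces of length $\delta$ with
$\delta^{N-d}\lesssim 2^{-k_d}$. On each piece Taylor polynomials approximate the first $d$
derivatives with error $\lesssim 2^{-k_d}$, and the minors become Wronskians of polynomials of
bounded degree.

The key fact (`exists_mixedWronskian_close`) is that if the Wronskians of orders up to $d$ have no
complex zero in a disc of radius $\rho$, then the mixed Wronskians are nearly constant at distances
up to $\varepsilon\rho$ from its centre. A Whitney partition relative to the real parts of the zeros
exploits this, with intervals that are short relative to their distance to the zeros. Intervals
shorter than a multiple of $2^{-k_d}$ need no such property, because there the mean value theorem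
suffices. Only $O(k_d+C_\gamma)$ geometric scales occur per zero. For $d\ge2$ this logarithm is
absorbed by the terms $1/(N-j)$, $j<d$, of the exponent; for $d=1$ it is avoided by cutting at level
sets instead. -/

/-- The determinant is Lipschitz on bounded sets of matrices, uniformly in the size. -/
theorem exists_abs_det_sub_det_le (d : ℕ) (K : ℝ) :
    ∃ C : ℝ, 0 < C ∧ ∀ j ≤ d, ∀ A B : Matrix (Fin j) (Fin j) ℝ, ∀ e : ℝ, 0 ≤ e →
      (∀ p q, |A p q| ≤ K) → (∀ p q, |B p q| ≤ K) → (∀ p q, |A p q - B p q| ≤ e) →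
      |A.det - B.det| ≤ C * e := by
  set c : ℕ → ℝ := fun j => (j.factorial : ℝ) * j * (max K 0) ^ (j - 1) with hc
  have hc0 : ∀ j, 0 ≤ c j := fun j => by positivity
  refine ⟨1 + ∑ j ∈ Finset.range (d + 1), c j, ?_, ?_⟩
  · have := Finset.sum_nonneg (s := Finset.range (d + 1)) fun j _ => hc0 j
    linarith
  intro j hj A B e he hA hB hAB
  have hK : (0 : ℝ) ≤ max K 0 := le_max_right _ _
  have hb : ∀ m : Fin j → Fin j → ℝ,
      ‖(Matrix.detRowAlternating (R := ℝ) (n := Fin j)).toMultilinearMap m‖ ≤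
        (j.factorial : ℝ) * ∏ i, ‖m i‖ := by
    intro m
    change |Matrix.det (Matrix.of m)| ≤ _
    rw [Matrix.det_apply]
    refine (Finset.abs_sum_le_sum_abs _ _).trans ?_
    simp only [Matrix.of_apply]
    have h1 : ∀ σ ∈ (Finset.univ : Finset (Equiv.Perm (Fin j))),
        |Equiv.Perm.sign σ • ∏ i, m (σ i) i| ≤ ∏ i, ‖m i‖ := by
      intro σ _
      have h2 : |Equiv.Perm.sign σ • ∏ i, m (σ i) i| = ∏ i, |m (σ i) i| := by
        rcases Int.units_eq_one_or (Equiv.Perm.sign σ) with h | h <;>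
          simp [h, Finset.abs_prod]
      rw [h2, ← Equiv.prod_comp σ (fun i => ‖m i‖)]
      exact Finset.prod_le_prod (fun i _ => abs_nonneg _) fun i _ => norm_le_pi_norm (m (σ i)) i
    refine (Finset.sum_le_sum h1).trans ?_
    simp [Fintype.card_perm]
  have h := MultilinearMap.norm_image_sub_le_of_bound _ (by positivity) hb A B
  have hn : ∀ M : Fin j → Fin j → ℝ, ∀ x : ℝ, 0 ≤ x → (∀ p q, |M p q| ≤ x) → ‖M‖ ≤ x := by
    intro M x hx hM
    exact (pi_norm_le_iff_of_nonneg hx).2 fun p => (pi_norm_le_iff_of_nonneg hx).2 fun q => hM p q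
  have hA' := hn A _ hK fun p q => (hA p q).trans (le_max_left _ _)
  have hB' := hn B _ hK fun p q => (hB p q).trans (le_max_left _ _)
  have hAB' := hn (fun p q => A p q - B p q) _ he hAB
  have h3 : |A.det - B.det| ≤ c j * e := by
    refine le_trans h ?_
    rw [hc]
    simp only [Fintype.card_fin]
    exact mul_le_mul (mul_le_mul_of_nonneg_left
      (pow_le_pow_left₀ (le_max_of_le_left (norm_nonneg _)) (max_le hA' hB') _) (by positivity))
      hAB' (norm_nonneg _) (by positivity)
  refine h3.trans (mul_le_mul_of_nonneg_right ?_ he)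
  have := Finset.single_le_sum (s := Finset.range (d + 1)) (fun j _ => hc0 j)
    (Finset.mem_range.2 (Nat.lt_succ_of_le hj))
  linarith

theorem exists_abs_coeff_prod_le (M : ℕ) (K : ℝ) (n : ℕ) :
    ∃ C : ℝ, 0 ≤ C ∧ ∀ F : Fin n → ℝ[X], (∀ i, ∀ b ≤ M, |(F i).coeff b| ≤ K) →
      ∀ b ≤ M, |(∏ i, F i).coeff b| ≤ C := by
  induction n with
  | zero =>
    refine ⟨1, zero_le_one, fun F _ b _ => ?_⟩
    simp only [Finset.univ_eq_empty, Finset.prod_empty, coeff_one]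
    split_ifs <;> simp
  | succ n ih =>
    obtain ⟨C, hC0, hC⟩ := ih
    refine ⟨(M + 1) * (|K| * C), by positivity, fun F hF b hb => ?_⟩
    rw [Fin.prod_univ_succ, coeff_mul]
    refine (Finset.abs_sum_le_sum_abs _ _).trans ?_
    have : ∀ x ∈ Finset.HasAntidiagonal.antidiagonal b,
        |(F 0).coeff x.1 * (∏ i, F (Fin.succ i)).coeff x.2| ≤ |K| * C := by
      intro x hx
      rw [Finset.HasAntidiagonal.mem_antidiagonal] at hx
      rw [abs_mul]
      exact mul_le_mul ((hF 0 _ (by omega)).trans (le_abs_self K))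
        (hC _ (fun i => hF _) _ (by omega)) (abs_nonneg _) (abs_nonneg _)
    refine (Finset.sum_le_card_nsmul _ _ _ this).trans ?_
    rw [Finset.Nat.card_antidiagonal, nsmul_eq_mul]
    have : ((b + 1 : ℕ) : ℝ) ≤ M + 1 := by exact_mod_cast Nat.succ_le_succ hb
    gcongr

theorem exists_abs_coeff_det_le (M : ℕ) (K : ℝ) (n : ℕ) :
    ∃ C : ℝ, 0 ≤ C ∧ ∀ A : Matrix (Fin n) (Fin n) ℝ[X],
      (∀ p q, ∀ b ≤ M, |(A p q).coeff b| ≤ K) → ∀ b ≤ M, |A.det.coeff b| ≤ C := by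
  obtain ⟨C, hC0, hC⟩ := exists_abs_coeff_prod_le M K n
  refine ⟨n.factorial * C, by positivity, fun A hA b hb => ?_⟩
  rw [Matrix.det_apply, finsetSum_coeff]
  refine (Finset.abs_sum_le_sum_abs _ _).trans ?_
  have : ∀ σ ∈ (Finset.univ : Finset (Equiv.Perm (Fin n))),
      |(Equiv.Perm.sign σ • ∏ i, A (σ i) i).coeff b| ≤ C := by
    intro σ _
    have := hC (fun i => A (σ i) i) (fun i => hA _ _) b hb
    rcases Int.units_eq_one_or (Equiv.Perm.sign σ) with h | h <;> simpa [h] using this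
  refine (Finset.sum_le_card_nsmul _ _ _ this).trans ?_
  simp [Fintype.card_perm]

/-- A real polynomial without complex roots in the open unit disc is controlled by its value at
the origin. -/
theorem abs_coeff_le_of_forall_root {P : ℝ[X]} {E : ℕ} (hE : P.natDegree ≤ E)
    (hP : ∀ z : ℂ, aeval z P = 0 → 1 ≤ ‖z‖) (n : ℕ) :
    |P.coeff n| ≤ 2 ^ E * |P.coeff 0| := by
  set Q : ℂ[X] := P.map (algebraMap ℝ ℂ) with hQ
  have hco : ∀ m, ‖Q.coeff m‖ = |P.coeff m| := fun m => by simp [hQ]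
  have hdeg : Q.natDegree = P.natDegree := natDegree_map _
  have h1 := norm_coeff_le_choose_mul_mahlerMeasure n Q
  -- Every root has modulus at least $1$, so each factor $\max(1,|z|)$ of the Mahler measure is
  -- $|z|$ and the measure collapses to the modulus of the constant coefficient.
  have h2 : Q.mahlerMeasure = ‖Q.coeff 0‖ := by
    rw [mahlerMeasure_eq_leadingCoeff_mul_prod_roots,
      (IsAlgClosed.splits Q).coeff_zero_eq_leadingCoeff_mul_prod_roots, norm_mul, norm_mul,
      norm_pow, norm_neg, norm_one, one_pow, one_mul]
    congr 1
    rw [show ‖Q.roots.prod‖ = (Q.roots.map fun z => ‖z‖).prod from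
      map_multiset_prod (normHom (α := ℂ)) Q.roots]
    congr 1
    refine Multiset.map_congr rfl fun z hz => max_eq_right (hP z ?_)
    have := (mem_roots'.1 hz).2
    rwa [hQ, IsRoot.def, eval_map_algebraMap] at this
  rw [hco, h2, hco, hdeg] at h1
  refine h1.trans (mul_le_mul_of_nonneg_right ?_ (abs_nonneg _))
  calc (P.natDegree.choose n : ℝ) ≤ 2 ^ P.natDegree := by exact_mod_cast Nat.choose_le_two_pow _ _
    _ ≤ 2 ^ E := pow_le_pow_right₀ (by norm_num) hE

/-! ### Wronskians without zeros in a disc -/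

/-- The Wronskian of `f 0, …, f (j - 1)`. -/
def wronskianDet (f : ℕ → ℝ[X]) (j : ℕ) : ℝ[X] :=
  Matrix.det (Matrix.of fun q p : Fin j => derivative^[(q : ℕ)] (f p))

/-- The Wronskian of `f 0, …, f (j - 1)`, with the row of order `q` evaluated at `s q`. -/
def mixedWronskian (f : ℕ → ℝ[X]) (j : ℕ) (s : Fin j → ℝ) : ℝ :=
  Matrix.det (Matrix.of fun q p : Fin j => (derivative^[(q : ℕ)] (f p)).eval (s q))

theorem eval_wronskianDet (f : ℕ → ℝ[X]) (j : ℕ) (t : ℝ) :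
    (wronskianDet f j).eval t = mixedWronskian f j fun _ => t := by
  rw [wronskianDet, mixedWronskian, ← coe_evalRingHom, RingHom.map_det]
  rfl

theorem wronskianDet_zero (f : ℕ → ℝ[X]) : wronskianDet f 0 = 1 := by
  simp [wronskianDet]

theorem natDegree_wronskianDet_le {f : ℕ → ℝ[X]} {D : ℕ} (j : ℕ)
    (hf : ∀ i, (f i).natDegree ≤ D) : (wronskianDet f j).natDegree ≤ j * D := by
  rw [wronskianDet, Matrix.det_apply]
  refine natDegree_sum_le_of_forall_le _ _ fun σ _ => ?_
  have h : (∏ i : Fin j, (Matrix.of fun q p : Fin j => derivative^[(q : ℕ)] (f p)) (σ i) i).natDegree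
      ≤ j * D := by
    refine (natDegree_prod_le _ _).trans ?_
    refine (Finset.sum_le_card_nsmul _ _ D fun i _ => ?_).trans (by simp)
    exact (natDegree_iterate_derivative _ _).trans ((Nat.sub_le _ _).trans (hf _))
  rcases Int.units_eq_one_or (Equiv.Perm.sign σ) with h' | h'
  · simpa [h'] using h
  · simpa [h'] using h

theorem abs_coeff_iterate_derivative_le {D : ℕ} {C : ℝ} {g : ℝ[X]} (hg : g.natDegree ≤ D)
    (hC : ∀ n ≤ D, |g.coeff n| ≤ C) (q n : ℕ) :
    |(derivative^[q] g).coeff n| ≤ D.factorial * C := by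
  have hC0 : 0 ≤ C := (abs_nonneg _).trans (hC 0 (Nat.zero_le _))
  rw [coeff_iterate_derivative, nsmul_eq_mul, abs_mul, Nat.abs_cast]
  by_cases h : n + q ≤ D
  · refine mul_le_mul ?_ (hC _ h) (abs_nonneg _) (by positivity)
    have h1 : (n + q).descFactorial q ≤ (n + q).factorial :=
      Nat.le_of_dvd (Nat.factorial_pos _)
        ⟨_, (by rw [mul_comm]; exact (Nat.factorial_mul_descFactorial (Nat.le_add_left q n)).symm)⟩
    exact_mod_cast h1.trans (Nat.factorial_le h)
  · rw [coeff_eq_zero_of_natDegree_lt (by omega)]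
    simp only [abs_zero, mul_zero]
    positivity

theorem abs_eval_sub_le_of_abs_coeff_le {D : ℕ} {C : ℝ} {g : ℝ[X]} (hg : g.natDegree ≤ D)
    (hC : ∀ n, |g.coeff n| ≤ C) {v : ℝ} (hv : |v| ≤ 1) :
    |g.eval v - g.eval 0| ≤ D * C * |v| := by
  rw [eval_eq_sum_range' (Nat.lt_succ_of_le hg), Finset.sum_range_succ', ← coeff_zero_eq_eval_zero]
  simp only [pow_zero, mul_one, add_sub_cancel_right]
  refine (Finset.abs_sum_le_sum_abs _ _).trans ?_
  have : ∀ n ∈ Finset.range D, |g.coeff (n + 1) * v ^ (n + 1)| ≤ C * |v| := by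
    intro n _
    rw [abs_mul, abs_pow]
    refine mul_le_mul (hC _) ?_ (by positivity) ((abs_nonneg _).trans (hC 0))
    calc |v| ^ (n + 1) ≤ |v| ^ 1 := pow_le_pow_of_le_one (abs_nonneg _) hv (by omega)
      _ = |v| := pow_one _
  refine (Finset.sum_le_card_nsmul _ _ _ this).trans ?_
  simp [mul_assoc]

/-- A triangular system of polynomials is controlled by its Wronskians. -/
theorem exists_abs_coeff_le_of_wronskianDet (D : ℕ) (K : ℝ) (p : ℕ) :
    ∃ C : ℝ, ∀ g : ℕ → ℝ[X], (∀ i, (g i).natDegree ≤ D) →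
      (∀ j ≤ p, ∀ n, |(wronskianDet g j).coeff n| ≤ K) →
      (∀ j ≤ p, (wronskianDet g j).coeff 0 = 1) →
      (∀ i < p, ∀ q < i, |(g i).coeff q| ≤ 1) →
      ∀ i < p, ∀ n ≤ D, |(g i).coeff n| ≤ C := by
  induction p with
  | zero => exact ⟨0, fun g _ _ _ _ i hi => absurd hi (Nat.not_lt_zero _)⟩
  | succ p ih =>
    obtain ⟨C₀, hC₀⟩ := ih
    obtain ⟨Cm, hCm0, hCm⟩ := exists_abs_coeff_det_le D (D.factorial * C₀) p
    -- With the earlier functions bounded, the Wronskian of order `p + 1` is a linear differential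
    -- expression in `g p` whose top coefficient is $1$ at $0$. The inner induction solves it as a
    -- power series, one coefficient of `g p` at a time.
    have key : ∀ N : ℕ, ∃ C : ℝ, ∀ g : ℕ → ℝ[X], (∀ i, (g i).natDegree ≤ D) →
      (∀ j ≤ p + 1, ∀ n, |(wronskianDet g j).coeff n| ≤ K) →
      (∀ j ≤ p + 1, (wronskianDet g j).coeff 0 = 1) →
      (∀ i < p + 1, ∀ q < i, |(g i).coeff q| ≤ 1) →
      ∀ n < N, n ≤ D → |(g p).coeff n| ≤ C := by
      intro N
      induction N with
      | zero => exact ⟨0, fun g _ _ _ _ n hn => absurd hn (Nat.not_lt_zero _)⟩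
      | succ N ihN =>
        obtain ⟨C₁, hC₁⟩ := ihN
        refine ⟨max (max C₁ 1) (K + (p + 1) * (N + 1) * ((N + p).factorial * |C₁| * Cm)), ?_⟩
        intro g hdeg hK h1 hlow n hn hnD
        rcases Nat.lt_succ_iff_lt_or_eq.1 hn with hn | rfl
        · exact (hC₁ g hdeg hK h1 hlow n hn hnD).trans ((le_max_left _ _).trans (le_max_left _ _))
        rcases lt_or_ge n p with hnp | hnp
        · exact (hlow p (Nat.lt_succ_self p) n hnp).trans
            ((le_max_right _ _).trans (le_max_left _ _))
        refine le_trans ?_ (le_max_right _ _)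
        obtain ⟨r, rfl⟩ : ∃ r, n = r + p := ⟨n - p, by omega⟩
        have hC₁' := hC₁ g hdeg hK h1 hlow
        have hC₀' := hC₀ g hdeg (fun j hj => hK j (by omega)) (fun j hj => h1 j (by omega))
          (fun i hi => hlow i (by omega))
        set m : Fin (p + 1) → ℝ[X] := fun q =>
          ((Matrix.of fun q p : Fin (p + 1) => derivative^[(q : ℕ)] (g p)).submatrix
            q.succAbove (Fin.last p).succAbove).det with hm
        have hmle : ∀ q, ∀ b ≤ D, |(m q).coeff b| ≤ Cm := by
          intro q b hb
          refine hCm _ (fun q' p' b' _ => ?_) b hb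
          simp only [Matrix.submatrix_apply, Matrix.of_apply, Fin.succAbove_last, Fin.val_castSucc]
          exact abs_coeff_iterate_derivative_le (hdeg _) (hC₀' p' p'.2) _ _
        have hmlast : m (Fin.last p) = wronskianDet g p := by
          rw [hm, wronskianDet]
          exact congrArg Matrix.det (Matrix.ext fun q' p' => by simp)
        -- In the expansion along the last column, the derivative of highest order, $p$, is
        -- multiplied by the Wronskian of order $p$, which is $1$ at the origin.
        have hexp : wronskianDet g (p + 1) =
            ∑ q : Fin (p + 1), (-1) ^ ((q : ℕ) + p) * (derivative^[(q : ℕ)] (g p) * m q) := by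
          rw [wronskianDet, Matrix.det_succ_column _ (Fin.last p)]
          refine Finset.sum_congr rfl fun q _ => ?_
          simp [hm, mul_assoc]
        have hsg : ∀ (q : ℕ) (P : ℝ[X]) (k : ℕ), ((-1) ^ q * P).coeff k = (-1) ^ q * P.coeff k := by
          intro q P k
          rcases neg_one_pow_eq_or ℝ[X] q with h | h <;> rcases Nat.even_or_odd q with h' | h' <;>
            simp [h'.neg_one_pow]
        set T : Fin (p + 1) × (ℕ × ℕ) → ℝ := fun x =>
          (-1) ^ ((x.1 : ℕ) + p) *
            ((derivative^[(x.1 : ℕ)] (g p)).coeff x.2.1 * (m x.1).coeff x.2.2) with hT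
        set S : Finset (Fin (p + 1) × (ℕ × ℕ)) :=
          Finset.univ ×ˢ Finset.HasAntidiagonal.antidiagonal r with hS
        have hcoeff : (wronskianDet g (p + 1)).coeff r = ∑ x ∈ S, T x := by
          rw [hexp, finsetSum_coeff, Finset.sum_product]
          refine Finset.sum_congr rfl fun q _ => ?_
          rw [hsg, coeff_mul, Finset.mul_sum]
        have hmem : (Fin.last p, (r, 0)) ∈ S := by simp [hS]
        have hT0 : T (Fin.last p, (r, 0)) =
            (r + p).descFactorial p * (g p).coeff (r + p) := by
          simp only [hT, Fin.val_last, hmlast, h1 p (by omega), mul_one, coeff_iterate_derivative,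
            nsmul_eq_mul, ← two_mul, pow_mul]
          norm_num
        have hrest : ∀ x ∈ S.erase (Fin.last p, (r, 0)),
            |T x| ≤ ((r + p + p).factorial * |C₁| * Cm) := by
          rintro ⟨q, α, β⟩ hx
          simp only [hS, Finset.mem_erase, Finset.mem_product, Finset.mem_univ, true_and,
            Finset.HasAntidiagonal.mem_antidiagonal, ne_eq, Prod.mk.injEq, not_and] at hx
          obtain ⟨hne, hab⟩ := hx
          have hq : (q : ℕ) < p + 1 := q.2
          -- Only the last row with `β = 0` reaches the coefficient of order `r + p`; every other
          -- term involves coefficients of `g p` of strictly lower order, which are already bounded.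
          have hlt : α + q < r + p := by
            by_contra hcon
            have hqp : (q : ℕ) = p := by omega
            exact hne (Fin.ext (by simpa using hqp)) (by omega) (by omega)
          simp only [hT]
          rw [abs_mul, abs_pow, abs_neg, abs_one, one_pow, one_mul, abs_mul,
            coeff_iterate_derivative, nsmul_eq_mul, abs_mul, Nat.abs_cast]
          have hfac : ((α + q).descFactorial q : ℝ) ≤ (r + p + p).factorial := by
            have h1 : (α + q).descFactorial q ≤ (α + q).factorial :=
              Nat.le_of_dvd (Nat.factorial_pos _) ⟨_, (by
                rw [mul_comm]
                exact (Nat.factorial_mul_descFactorial (Nat.le_add_left (q : ℕ) α)).symm)⟩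
            exact_mod_cast h1.trans (Nat.factorial_le (by omega))
          have hc : |(g p).coeff (α + q)| ≤ |C₁| :=
            (hC₁' _ hlt (by omega)).trans (le_abs_self _)
          exact mul_le_mul (mul_le_mul hfac hc (abs_nonneg _) (by positivity))
            (hmle _ _ (by omega)) (abs_nonneg _) (by positivity)
        have hsum := Finset.add_sum_erase S T hmem
        rw [← hcoeff, hT0] at hsum
        have hR : |∑ x ∈ S.erase (Fin.last p, (r, 0)), T x| ≤
            (p + 1) * (((r + p : ℕ) : ℝ) + 1) * ((r + p + p).factorial * |C₁| * Cm) := by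
          refine (Finset.abs_sum_le_sum_abs _ _).trans ?_
          refine (Finset.sum_le_card_nsmul _ _ _ hrest).trans ?_
          rw [nsmul_eq_mul]
          refine mul_le_mul_of_nonneg_right ?_ (by positivity)
          have h2 : (S.erase (Fin.last p, (r, 0))).card ≤ (p + 1) * (r + p + 1) := by
            refine (Finset.card_le_card (Finset.erase_subset _ _)).trans ?_
            rw [hS, Finset.card_product, Finset.Nat.card_antidiagonal, Finset.card_univ,
              Fintype.card_fin]
            exact Nat.mul_le_mul_left _ (by omega)
          exact_mod_cast h2
        have hdf : (1 : ℝ) ≤ (r + p).descFactorial p := by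
          exact_mod_cast Nat.succ_le_of_lt (Nat.descFactorial_pos.2 (Nat.le_add_left _ _))
        have hK' := hK (p + 1) le_rfl r
        have h3 : |((r + p).descFactorial p : ℝ) * (g p).coeff (r + p)| ≤
            K + (p + 1) * (((r + p : ℕ) : ℝ) + 1) * ((r + p + p).factorial * |C₁| * Cm) := by
          rw [show ((r + p).descFactorial p : ℝ) * (g p).coeff (r + p) =
            (wronskianDet g (p + 1)).coeff r -
              ∑ x ∈ S.erase (Fin.last p, (r, 0)), T x by linarith]
          exact (abs_sub _ _).trans (add_le_add hK' hR)
        refine le_trans ?_ h3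
        rw [abs_mul, Nat.abs_cast]
        exact le_mul_of_one_le_left (abs_nonneg _) hdf
    obtain ⟨C₁, hC₁⟩ := key (D + 1)
    refine ⟨max C₀ C₁, fun g hdeg hK h1 hlow i hi n hn => ?_⟩
    rcases Nat.lt_succ_iff_lt_or_eq.1 hi with hi | rfl
    · exact (hC₀ g hdeg (fun j hj => hK j (by omega)) (fun j hj => h1 j (by omega))
          (fun i hi => hlow i (by omega)) i hi n hn).trans (le_max_left _ _)
    · exact (hC₁ g hdeg hK h1 hlow n (by omega) hn).trans (le_max_right _ _)

/-- Triangular normalisation of a matrix with invertible leading blocks. -/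
theorem exists_upperTriangular_normalisation (A : ℕ → ℕ → ℝ) (d : ℕ)
    (h : ∀ j ≤ d, Matrix.det (Matrix.of fun q p : Fin j => A q p) ≠ 0) :
    ∃ U : ℕ → ℕ → ℝ, (∀ i p, p < i → U i p = 0) ∧
      ∀ p < d, ∀ q ≤ p, ∑ i ∈ Finset.range (p + 1), A q i * U i p = if q = p then 1 else 0 := by
  -- Column `p` of `U` solves the leading system of size `p + 1` whose right-hand side is the last
  -- unit vector.
  set u : ∀ p : ℕ, Fin (p + 1) → ℝ := fun p =>
    (Matrix.of fun q i : Fin (p + 1) => A q i)⁻¹.mulVec (Pi.single (Fin.last p) 1) with hu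
  refine ⟨fun i p => if hi : i < p + 1 then u p ⟨i, hi⟩ else 0, ?_, ?_⟩
  · intro i p hip
    simp only
    rw [dif_neg (by omega)]
  · intro p hp q hq
    have h1 : (Matrix.of fun q i : Fin (p + 1) => A q i).mulVec (u p) = Pi.single (Fin.last p) 1 := by
      rw [hu, Matrix.mulVec_mulVec, Matrix.mul_nonsing_inv _ (isUnit_iff_ne_zero.2 (h _ hp)),
        Matrix.one_mulVec]
    have h2 := congrFun h1 ⟨q, Nat.lt_succ_of_le hq⟩
    rw [Finset.sum_range]
    simp only [Matrix.mulVec, dotProduct, Matrix.of_apply] at h2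
    refine (Finset.sum_congr rfl fun i _ => ?_).trans (h2.trans ?_)
    · simp only
      rw [dif_pos i.2]
    · simp [Pi.single_apply, Fin.ext_iff]

theorem iterate_derivative_sum_C_mul (f : ℕ → ℝ[X]) (c : ℕ → ℝ) (n q : ℕ) :
    derivative^[q] (∑ i ∈ Finset.range n, C (c i) * f i) =
      ∑ i ∈ Finset.range n, C (c i) * derivative^[q] (f i) := by
  rw [iterate_derivative_sum]
  exact Finset.sum_congr rfl fun i _ => iterate_derivative_C_mul _ _ _

/-- Mixed Wronskians of polynomials whose Wronskians have no complex zeros in the unit disc are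
nearly constant close to the origin. -/
theorem exists_mixedWronskian_close_zero (d D : ℕ) :
    ∃ ε : ℝ, 0 < ε ∧ ε ≤ 1 ∧ ∀ f : ℕ → ℝ[X], (∀ i, (f i).natDegree ≤ D) →
      (∀ j ≤ d, ∀ z : ℂ, aeval z (wronskianDet f j) = 0 → 1 ≤ ‖z‖) →
      ∀ j ≤ d, ∀ s : Fin j → ℝ, (∀ q, |s q| ≤ ε) →
        |mixedWronskian f j s - mixedWronskian f j 0| ≤ 1 / 8 * |mixedWronskian f j 0| := by
  obtain ⟨C₀, hC₀⟩ := exists_abs_coeff_le_of_wronskianDet D (2 ^ (d * D)) d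
  set C₁ : ℝ := D.factorial * |C₀| with hC₁
  set K : ℝ := D * C₁ + C₁ with hK
  obtain ⟨L, hL0, hL⟩ := exists_abs_det_sub_det_le d K
  have hC₁0 : 0 ≤ C₁ := by positivity
  have hK0 : 0 ≤ K := by positivity
  refine ⟨1 / (8 * L * K + 1), by positivity, ?_, ?_⟩
  · rw [div_le_one (by positivity)]
    have : 0 ≤ 8 * L * K := by positivity
    linarith
  intro f hf hroot j hj s hs
  have hne : ∀ j ≤ d, (wronskianDet f j).coeff 0 ≠ 0 := by
    intro j hj h0
    have := hroot j hj 0 (by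
      rw [← coeff_zero_eq_aeval_zero']
      simp [h0])
    simp at this
    linarith
  -- After this change of functions the matrix of derivatives at $0$ is lower triangular with unit
  -- diagonal. A triangular change multiplies all Wronskians of order $j$, mixed or not, by the same
  -- constant `u j`, so a relative estimate is not affected.
  obtain ⟨U, hU0, hU⟩ := exists_upperTriangular_normalisation
    (fun q p => (derivative^[q] (f p)).eval 0) d (fun j hj => by
      have := hne j hj
      rwa [coeff_zero_eq_eval_zero, eval_wronskianDet] at this)
  set g : ℕ → ℝ[X] := fun p =>
    if p < d then ∑ i ∈ Finset.range (p + 1), C (U i p) * f i else 0 with hg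
  have hgp : ∀ p < d, g p = ∑ i ∈ Finset.range (p + 1), C (U i p) * f i := fun p hp => by
    simp only [hg]
    rw [if_pos hp]
  have hgdeg : ∀ i, (g i).natDegree ≤ D := by
    intro i
    simp only [hg]
    split_ifs
    · exact natDegree_sum_le_of_forall_le _ _ fun k _ => (natDegree_C_mul_le _ _).trans (hf k)
    · simp
  have hgeval : ∀ p < d, ∀ q ≤ p, (derivative^[q] (g p)).eval 0 = if q = p then 1 else 0 := by
    intro p hp q hq
    rw [hgp p hp, iterate_derivative_sum_C_mul, eval_finsetSum, ← hU p hp q hq]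
    exact Finset.sum_congr rfl fun i _ => by rw [eval_mul, eval_C, mul_comm]
  have hsum : ∀ j ≤ d, ∀ (p : Fin j) (q : ℕ), derivative^[q] (g p) =
      ∑ i : Fin j, derivative^[q] (f i) * C (U i p) := by
    intro j hj p q
    rw [hgp p (by omega), iterate_derivative_sum_C_mul,
      Fin.sum_univ_eq_sum_range (fun i => derivative^[q] (f i) * C (U i p)) j]
    refine (Finset.sum_congr rfl fun i _ => mul_comm _ _).trans ?_
    refine Finset.sum_subset (Finset.range_subset_range.2 (by omega)) fun i _ hi => ?_
    rw [hU0 _ _ (by simpa using hi), C_0, mul_zero]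
  set u : ∀ j : ℕ, ℝ := fun j => Matrix.det (Matrix.of fun i p : Fin j => U i p) with hu
  have hmix : ∀ j ≤ d, ∀ s : Fin j → ℝ, mixedWronskian g j s = mixedWronskian f j s * u j := by
    intro j hj s
    rw [hu, mixedWronskian, mixedWronskian, ← Matrix.det_mul]
    refine congrArg Matrix.det (Matrix.ext fun q p => ?_)
    simp [Matrix.mul_apply, hsum j hj, eval_finsetSum]
  have hwr : ∀ j ≤ d, wronskianDet g j = wronskianDet f j * C (u j) := by
    intro j hj
    rw [hu, wronskianDet, wronskianDet, RingHom.map_det, ← Matrix.det_mul]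
    refine congrArg Matrix.det (Matrix.ext fun q p => ?_)
    simp [Matrix.mul_apply, hsum j hj]
  have hone : ∀ j ≤ d, mixedWronskian g j 0 = 1 := by
    intro j hj
    rw [mixedWronskian, Matrix.det_of_isLowerTriangular]
    · refine Finset.prod_eq_one fun p _ => ?_
      simp [hgeval p (by omega) p le_rfl]
    · intro q p hqp
      have hqp : (q : ℕ) < p := by simpa using hqp
      simp [hgeval p (by omega) q hqp.le, hqp.ne]
  have hw0 : ∀ j ≤ d, (wronskianDet g j).coeff 0 = 1 := by
    intro j hj
    rw [coeff_zero_eq_eval_zero, eval_wronskianDet]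
    exact hone j hj
  -- The normalised Wronskians have constant coefficient $1$ and no zero in the open unit disc.
  -- Their coefficients are thus bounded uniformly, hence so are those of the `g i`, and only then
  -- does a universal radius `ε` become possible.
  have hwK : ∀ j ≤ d, ∀ n, |(wronskianDet g j).coeff n| ≤ 2 ^ (d * D) := by
    intro j hj n
    have h1 := abs_coeff_le_of_forall_root (P := wronskianDet g j) (E := d * D)
      ((natDegree_wronskianDet_le j hgdeg).trans (Nat.mul_le_mul_right _ hj)) (fun z hz => by
        have hu0 : u j ≠ 0 := by
          intro h0
          have := hmix j hj 0
          rw [hone j hj, h0, mul_zero] at this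
          exact one_ne_zero this
        refine hroot j hj z ?_
        rw [hwr j hj, map_mul, aeval_C] at hz
        exact (mul_eq_zero.1 hz).resolve_right (by simpa using hu0)) n
    rwa [hw0 j hj, abs_one, mul_one] at h1
  have hgC : ∀ i < d, ∀ n ≤ D, |(g i).coeff n| ≤ |C₀| := by
    intro i hi n hn
    refine (hC₀ g hgdeg hwK hw0 (fun i hi q hq => ?_) i hi n hn).trans (le_abs_self _)
    have h1 := hgeval i hi q hq.le
    rw [if_neg hq.ne, ← coeff_zero_eq_eval_zero, coeff_iterate_derivative, zero_add,
      Nat.descFactorial_self, nsmul_eq_mul] at h1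
    rw [(mul_eq_zero.1 h1).resolve_left (by positivity)]
    simp
  have hco : ∀ i < d, ∀ q n, |(derivative^[q] (g i)).coeff n| ≤ C₁ := fun i hi q n =>
    abs_coeff_iterate_derivative_le (hgdeg i) (hgC i hi) q n
  have hdd : ∀ i q, (derivative^[q] (g i)).natDegree ≤ D := fun i q =>
    (natDegree_iterate_derivative _ _).trans ((Nat.sub_le _ _).trans (hgdeg _))
  set ε : ℝ := 1 / (8 * L * K + 1) with hε
  have hε0 : 0 < ε := by positivity
  have hε1 : ε ≤ 1 := by
    rw [hε, div_le_one (by positivity)]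
    have : 0 ≤ 8 * L * K := by positivity
    linarith
  have hKε : L * (K * ε) ≤ 1 / 8 := by
    rw [hε, ← mul_assoc, mul_one_div, div_le_div_iff₀ (by positivity) (by norm_num)]
    linarith
  have hdiff : ∀ i < d, ∀ (q : ℕ) (v : ℝ), |v| ≤ ε →
      |(derivative^[q] (g i)).eval v - (derivative^[q] (g i)).eval 0| ≤ D * C₁ * |v| :=
    fun i hi q v hv => abs_eval_sub_le_of_abs_coeff_le (hdd i q) (hco i hi q) (hv.trans hε1)
  have hz : ∀ i < d, ∀ q : ℕ, |(derivative^[q] (g i)).eval 0| ≤ C₁ := fun i hi q => by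
    rw [← coeff_zero_eq_eval_zero]
    exact hco i hi q 0
  have hclose : |mixedWronskian g j s - mixedWronskian g j 0| ≤ L * (K * ε) := by
    refine hL j hj _ _ _ (by positivity) (fun q p => ?_) (fun q p => ?_) (fun q p => ?_)
    · have h1 := hdiff p (by omega) q (s q) (hs q)
      have h2 := hz p (by omega) q
      have h3 : D * C₁ * |s q| ≤ D * C₁ * 1 :=
        mul_le_mul_of_nonneg_left ((hs q).trans hε1) (by positivity)
      simp only [Matrix.of_apply]
      rw [abs_le] at h1 h2 ⊢
      constructor <;> linarith [h1.1, h1.2, h2.1, h2.2]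
    · have h2 := hz p (by omega) q
      simp only [Matrix.of_apply, Pi.zero_apply]
      refine h2.trans ?_
      rw [hK]
      have : 0 ≤ D * C₁ := by positivity
      linarith
    · simp only [Matrix.of_apply, Pi.zero_apply]
      refine (hdiff p (by omega) q (s q) (hs q)).trans ?_
      refine mul_le_mul ?_ (hs q) (abs_nonneg _) hK0
      rw [hK]
      linarith
  have hclose' := hclose.trans hKε
  have hu1 := hmix j hj 0
  rw [hone j hj] at hu1 hclose'
  rw [hmix j hj s] at hclose'
  have hF : mixedWronskian f j s - mixedWronskian f j 0 =
      (mixedWronskian f j s * u j - 1) * mixedWronskian f j 0 := by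
    rw [sub_mul, one_mul, mul_assoc, mul_comm (u j), ← hu1, mul_one]
  rw [hF, abs_mul]
  exact mul_le_mul_of_nonneg_right hclose' (abs_nonneg _)

theorem iterate_derivative_comp_linear (f : ℝ[X]) (ρ t : ℝ) (q : ℕ) :
    derivative^[q] (f.comp (C ρ * X + C t)) =
      C (ρ ^ q) * (derivative^[q] f).comp (C ρ * X + C t) := by
  induction q with
  | zero => simp
  | succ q ih =>
    rw [Function.iterate_succ_apply', ih, Function.iterate_succ_apply', derivative_C_mul,
      derivative_comp]
    simp only [derivative_add, derivative_mul, derivative_C, derivative_X, zero_mul, mul_one,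
      zero_add, add_zero, pow_succ, C_mul]
    ring

/-- Mixed Wronskians of polynomials whose Wronskians have no complex zeros in the disc of radius
`ρ` around `t` are nearly constant close to `t`. -/
theorem exists_mixedWronskian_close (d D : ℕ) :
    ∃ ε : ℝ, 0 < ε ∧ ε ≤ 1 ∧ ∀ f : ℕ → ℝ[X], (∀ i, (f i).natDegree ≤ D) →
      ∀ t ρ : ℝ, 0 < ρ →
      (∀ j ≤ d, ∀ z : ℂ, aeval z (wronskianDet f j) = 0 → ρ ≤ ‖z - t‖) →
      ∀ j ≤ d, ∀ s : Fin j → ℝ, (∀ q, |s q - t| ≤ ε * ρ) →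
        |mixedWronskian f j s - mixedWronskian f j fun _ => t| ≤
          1 / 8 * |mixedWronskian f j fun _ => t| := by
  obtain ⟨ε, hε0, hε1, hε⟩ := exists_mixedWronskian_close_zero d D
  refine ⟨ε, hε0, hε1, fun f hf t ρ hρ hroot j hj s hs => ?_⟩
  -- Affine rescaling to the unit disc. The chain rule multiplies the row of order $q$ by $\rho^q$,
  -- so Wronskians of order $j$ all acquire the factor `c j`, which cancels at the end.
  set g : ℕ → ℝ[X] := fun i => (f i).comp (C ρ * X + C t) with hg
  set c : ℕ → ℝ := fun j => ∏ q : Fin j, ρ ^ (q : ℕ) with hc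
  have hc0 : ∀ j, c j ≠ 0 := fun j => Finset.prod_ne_zero_iff.2 fun q _ => (pow_pos hρ _).ne'
  have hdeg : ∀ i, (g i).natDegree ≤ D := by
    intro i
    refine natDegree_comp_le.trans ?_
    calc (f i).natDegree * (C ρ * X + C t).natDegree ≤ D * 1 :=
          Nat.mul_le_mul (hf i) (natDegree_linear_le)
      _ = D := mul_one D
  have hmix : ∀ j, ∀ v : Fin j → ℝ,
      mixedWronskian g j v = c j * mixedWronskian f j fun q => ρ * v q + t := by
    intro j v
    rw [mixedWronskian, mixedWronskian, hc, ← Matrix.det_mul_column]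
    refine congrArg Matrix.det (Matrix.ext fun q p => ?_)
    simp [hg, iterate_derivative_comp_linear, eval_comp]
  have hwr : ∀ j, wronskianDet g j = C (c j) * (wronskianDet f j).comp (C ρ * X + C t) := by
    intro j
    refine funext fun v => ?_
    rw [eval_wronskianDet, hmix, eval_mul, eval_C, eval_comp, eval_wronskianDet]
    simp
  have hroot' : ∀ j ≤ d, ∀ z : ℂ, aeval z (wronskianDet g j) = 0 → 1 ≤ ‖z‖ := by
    intro j hj z hz
    rw [hwr, map_mul, aeval_C, aeval_comp] at hz
    have h1 := (mul_eq_zero.1 hz).resolve_left (by simpa using hc0 j)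
    have h2 := hroot j hj _ h1
    have h3 : aeval z (C ρ * X + C t : ℝ[X]) - (t : ℂ) = ρ * z := by simp
    rw [h3, norm_mul, Complex.norm_real, Real.norm_of_nonneg hρ.le] at h2
    exact le_of_mul_le_mul_left (by simpa using h2) hρ
  have h := hε g hdeg hroot' j hj (fun q => (s q - t) / ρ) (fun q => by
    rw [abs_div, abs_of_pos hρ, div_le_iff₀ hρ]
    exact hs q)
  rw [hmix, hmix, ← mul_sub, abs_mul, abs_mul, mul_left_comm] at h
  have h' := le_of_mul_le_mul_left h (abs_pos.2 (hc0 j))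
  have e1 : (fun q : Fin j => ρ * ((s q - t) / ρ) + t) = s := by
    ext q
    field_simp
    ring
  have e2 : (fun q : Fin j => ρ * (0 : Fin j → ℝ) q + t) = fun _ => t := by
    ext q
    simp
  rwa [e1, e2] at h'

/-! ### Partitions of an interval -/

open Polynomial Set

/-- A list of intervals covers `[u,v]` without overlapping. -/
structure IsPartition (u v : ℝ) (l : List (ℝ × ℝ)) : Prop where
  mem : ∀ I ∈ l, u ≤ I.1 ∧ I.1 ≤ I.2 ∧ I.2 ≤ v
  cover : ∀ t ∈ Icc u v, ∃ I ∈ l, t ∈ Icc I.1 I.2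
  length_sum : (l.map fun I => I.2 - I.1).sum = v - u

theorem IsPartition.append {u w v : ℝ} {l₁ l₂ : List (ℝ × ℝ)} (h₁ : IsPartition u w l₁)
    (h₂ : IsPartition w v l₂) (huw : u ≤ w) (hwv : w ≤ v) : IsPartition u v (l₁ ++ l₂) where
  mem I hI := by
    rcases List.mem_append.1 hI with hI | hI
    · have := h₁.mem I hI
      exact ⟨this.1, this.2.1, this.2.2.trans hwv⟩
    · have := h₂.mem I hI
      exact ⟨huw.trans this.1, this.2⟩
  cover t ht := by
    rcases le_total t w with h | h
    · obtain ⟨I, hI, hI'⟩ := h₁.cover t ⟨ht.1, h⟩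
      exact ⟨I, List.mem_append_left _ hI, hI'⟩
    · obtain ⟨I, hI, hI'⟩ := h₂.cover t ⟨h, ht.2⟩
      exact ⟨I, List.mem_append_right _ hI, hI'⟩
  length_sum := by
    rw [List.map_append, List.sum_append, h₁.length_sum, h₂.length_sum]
    ring

/-- A finite set of points partitions an interval. -/
theorem exists_isPartition_of_finset (S : Finset ℝ) {u v : ℝ} (huv : u ≤ v) :
    ∃ l, IsPartition u v l ∧ l.length ≤ S.card + 1 ∧ ∀ I ∈ l, ∀ s ∈ S, s ∉ Ioo I.1 I.2 := by
  induction h : S.card using Nat.strong_induction_on generalizing S u v with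
  | _ n ih =>
    by_cases hs : ∃ s ∈ S, s ∈ Ioo u v
    · obtain ⟨s, hsS, hs⟩ := hs
      have hcard : (S.filter (· < s)).card + (S.filter (s < ·)).card + 1 ≤ n := by
        have h1 : Disjoint (S.filter (· < s)) (S.filter (s < ·)) :=
          Finset.disjoint_filter.2 fun x _ h1 h2 => lt_asymm h1 h2
        have h2 : S.filter (· < s) ∪ S.filter (s < ·) ⊆ S.erase s := by
          intro x hx
          simp only [Finset.mem_union, Finset.mem_filter, Finset.mem_erase] at hx ⊢
          rcases hx with hx | hx
          · exact ⟨hx.2.ne, hx.1⟩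
          · exact ⟨hx.2.ne', hx.1⟩
        have h3 := Finset.card_le_card h2
        rw [Finset.card_union_of_disjoint h1] at h3
        have h4 := Finset.card_erase_add_one hsS
        omega
      obtain ⟨l₁, hp₁, hl₁, hS₁⟩ := ih _ (by omega) (S.filter (· < s)) hs.1.le rfl
      obtain ⟨l₂, hp₂, hl₂, hS₂⟩ := ih _ (by omega) (S.filter (s < ·)) hs.2.le rfl
      refine ⟨l₁ ++ l₂, hp₁.append hp₂ hs.1.le hs.2.le, ?_, ?_⟩
      · rw [List.length_append]
        omega
      · intro I hI r hr hrI
        rcases List.mem_append.1 hI with hI | hI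
        · exact hS₁ I hI r (Finset.mem_filter.2 ⟨hr, hrI.2.trans_le (hp₁.mem I hI).2.2⟩) hrI
        · exact hS₂ I hI r (Finset.mem_filter.2 ⟨hr, (hp₂.mem I hI).1.trans_lt hrI.1⟩) hrI
    · push Not at hs
      refine ⟨[(u, v)], ⟨?_, ?_, ?_⟩, by simp, ?_⟩
      · intro I hI
        rw [List.mem_singleton.1 hI]
        exact ⟨le_rfl, huv, le_rfl⟩
      · exact fun t ht => ⟨(u, v), by simp, ht⟩
      · simp
      · intro I hI s hsS
        rw [List.mem_singleton.1 hI]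
        exact hs s hsS

/-- Consecutive points $\eta(1+\varepsilon)^i$ and $\eta(1+\varepsilon)^{i+1}$ differ by
$\varepsilon$ times the smaller one, so an interval at distance $r$ that crosses none of them has
length at most $\varepsilon r$. Beyond the last point the a priori bound on $w$ takes over. -/
theorem le_mul_of_forall_not_mem_geometric {η ε r w : ℝ} {m : ℕ} (hη : 0 < η) (hε : 0 < ε)
    (hr : η ≤ r) (hw : w ≤ ε * η * (1 + ε) ^ m)
    (h : ∀ i ≤ m, ¬ (r < η * (1 + ε) ^ i ∧ η * (1 + ε) ^ i < r + w)) : w ≤ ε * r := by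
  by_cases hrm : η * (1 + ε) ^ m ≤ r
  · calc w ≤ ε * (η * (1 + ε) ^ m) := by linarith
      _ ≤ ε * r := mul_le_mul_of_nonneg_left hrm hε.le
  · push Not at hrm
    obtain ⟨i, hi1, hi2⟩ := exists_nat_pow_near (x := r / η) (y := 1 + ε)
      ((one_le_div hη).2 hr) (by linarith)
    rw [le_div_iff₀ hη] at hi1
    rw [div_lt_iff₀ hη] at hi2
    have him : i < m := by
      refine (pow_lt_pow_iff_right₀ (by linarith : 1 < 1 + ε)).1 ?_
      exact lt_of_mul_lt_mul_right (by linarith : (1 + ε) ^ i * η < (1 + ε) ^ m * η) hη.le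
    have h1 := h (i + 1) him
    rw [not_and, not_lt] at h1
    have h2 := h1 (by linarith)
    have h3 : η * (1 + ε) ^ (i + 1) = (1 + ε) ^ i * η + ε * ((1 + ε) ^ i * η) := by ring
    have h4 := mul_le_mul_of_nonneg_left hi1 hε.le
    linarith

/-- A Whitney type partition of an interval with respect to a finite set of points. -/
theorem exists_isPartition_whitney (Z : Finset ℝ) {u v η ε : ℝ} {m : ℕ} (huv : u ≤ v) (hη : 0 < η)
    (hε : 0 < ε) (hm : v - u ≤ ε * η * (1 + ε) ^ m) :
    ∃ l, IsPartition u v l ∧ l.length ≤ Z.card * (2 * (m + 1)) + 1 ∧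
      ∀ I ∈ l, I.2 - I.1 ≤ 2 * η ∨ ∀ z ∈ Z, ∀ t ∈ Icc I.1 I.2, I.2 - I.1 ≤ ε * |t - z| := by
  set S : Finset ℝ := Z.biUnion fun z =>
    (Finset.range (m + 1)).image (fun i => z + η * (1 + ε) ^ i) ∪
      (Finset.range (m + 1)).image (fun i => z - η * (1 + ε) ^ i) with hS
  have hcard : S.card ≤ Z.card * (2 * (m + 1)) := by
    refine Finset.card_biUnion_le_card_mul _ _ _ fun z _ => ?_
    refine (Finset.card_union_le _ _).trans ?_
    have h1 := Finset.card_image_le (s := Finset.range (m + 1)) (f := fun i => z + η * (1 + ε) ^ i)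
    have h2 := Finset.card_image_le (s := Finset.range (m + 1)) (f := fun i => z - η * (1 + ε) ^ i)
    rw [Finset.card_range] at h1 h2
    omega
  obtain ⟨l, hl, hlen, hl'⟩ := exists_isPartition_of_finset S huv
  refine ⟨l, hl, hlen.trans (by omega), fun I hI => ?_⟩
  by_cases hI2 : I.2 - I.1 ≤ 2 * η
  · exact Or.inl hI2
  push Not at hI2
  refine Or.inr fun z hz t ht => ?_
  have hIm := hl.mem I hI
  have hplus : ∀ i ≤ m, ¬ (I.1 < z + η * (1 + ε) ^ i ∧ z + η * (1 + ε) ^ i < I.2) := by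
    intro i hi
    refine hl' I hI _ (Finset.mem_biUnion.2 ⟨z, hz, Finset.mem_union_left _ ?_⟩)
    exact Finset.mem_image.2 ⟨i, Finset.mem_range.2 (by omega), rfl⟩
  have hminus : ∀ i ≤ m, ¬ (I.1 < z - η * (1 + ε) ^ i ∧ z - η * (1 + ε) ^ i < I.2) := by
    intro i hi
    refine hl' I hI _ (Finset.mem_biUnion.2 ⟨z, hz, Finset.mem_union_right _ ?_⟩)
    exact Finset.mem_image.2 ⟨i, Finset.mem_range.2 (by omega), rfl⟩
  have hw : I.2 - I.1 ≤ ε * η * (1 + ε) ^ m := by linarith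
  -- The points $z\pm\eta$ are not interior to the interval, whose length exceeds $2\eta$. It
  -- therefore lies entirely on one side, at distance at least $\eta$ from $z$.
  have hp0 := hplus 0 (Nat.zero_le _)
  have hm0 := hminus 0 (Nat.zero_le _)
  rw [pow_zero, mul_one, not_and, not_lt] at hp0 hm0
  by_cases hc : z + η ≤ I.1
  · have h1 := le_mul_of_forall_not_mem_geometric (r := I.1 - z) (w := I.2 - I.1) hη hε
      (by linarith) hw (fun i hi hcon => hplus i hi ⟨by linarith, by linarith⟩)
    refine h1.trans (mul_le_mul_of_nonneg_left ?_ hε.le)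
    exact (by linarith [ht.1] : I.1 - z ≤ t - z).trans (le_abs_self _)
  · push Not at hc
    have h2 := hp0 hc
    have hc' : I.2 ≤ z - η := by
      by_contra hcon
      push Not at hcon
      by_cases h3 : I.1 < z - η
      · exact absurd (hm0 h3) (by linarith)
      · linarith
    have h1 := le_mul_of_forall_not_mem_geometric (r := z - I.2) (w := I.2 - I.1) hη hε
      (by linarith) hw (fun i hi hcon => hminus i hi ⟨by linarith, by linarith⟩)
    refine h1.trans (mul_le_mul_of_nonneg_left ?_ hε.le)
    rw [abs_sub_comm]
    exact (by linarith [ht.2] : z - I.2 ≤ z - t).trans (le_abs_self _)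

/-! ### Partitions adapted to a polynomial curve -/

/-- The sequence of derivatives of the components of a polynomial curve, permuted by `σ`. -/
def permutedDerivatives {d : ℕ} (T : Fin d → ℝ[X]) (σ : Equiv.Perm (Fin d)) (i : ℕ) : ℝ[X] :=
  if h : i < d then derivative (T (σ ⟨i, h⟩)) else 0

theorem permutedDerivatives_apply {d : ℕ} (T : Fin d → ℝ[X]) (σ : Equiv.Perm (Fin d)) {j : ℕ}
    (hj : j ≤ d) (p : Fin j) :
    permutedDerivatives T σ p = derivative (T (σ (Fin.castLE hj p))) := by
  rw [permutedDerivatives, dif_pos (p.2.trans_le hj)]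
  rfl

theorem natDegree_permutedDerivatives_le {d D : ℕ} {T : Fin d → ℝ[X]}
    (hT : ∀ i, (T i).natDegree ≤ D) (σ : Equiv.Perm (Fin d)) (i : ℕ) :
    (permutedDerivatives T σ i).natDegree ≤ D := by
  unfold permutedDerivatives
  split_ifs
  · exact (natDegree_derivative_le _).trans ((Nat.sub_le _ _).trans (hT _))
  · simp

/-- The mixed minors of a polynomial curve are nearly constant on an interval `I` whose length is
small in terms of the lower bound `κ`, or in terms of the distance to the zeros of the minors. -/
theorem exists_isPartition_mixedWronskian (d D : ℕ) (B : ℝ) :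
    ∃ c : ℝ, 0 < c ∧ ∃ A : ℕ, ∀ T : Fin d → ℝ[X], (∀ i, (T i).natDegree ≤ D) →
      ∀ u v : ℝ, u ≤ v → (∀ i q, ∀ s ∈ Icc u v, |(derivative^[q] (T i)).eval s| ≤ B) →
      ∀ κ : ℝ, 0 < κ → ∀ y : ℕ, v - u ≤ c * κ * 2 ^ y →
      ∃ l, IsPartition u v l ∧ l.length ≤ A * (y + 1) ∧
        ∀ I ∈ l, ∀ σ : Equiv.Perm (Fin d), ∀ t ∈ Icc I.1 I.2,
          (∀ j, 1 ≤ j → j ≤ d →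
            κ ≤ |mixedWronskian (permutedDerivatives T σ) j fun _ => t|) →
          ∀ j, 1 ≤ j → j ≤ d → ∀ s : Fin j → ℝ, (∀ q, s q ∈ Icc I.1 I.2) →
            |mixedWronskian (permutedDerivatives T σ) j s -
              mixedWronskian (permutedDerivatives T σ) j fun _ => t| ≤
              1 / 8 * |mixedWronskian (permutedDerivatives T σ) j fun _ => t| := by
  obtain ⟨ε, hε0, hε1, hε⟩ := exists_mixedWronskian_close d D
  obtain ⟨L, hL0, hL⟩ := exists_abs_det_sub_det_le d B
  obtain ⟨A₀, hA₀⟩ := pow_unbounded_of_one_lt (2 : ℝ) (by linarith : 1 < 1 + ε)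
  set R : ℕ := d.factorial * ((d + 1) * (d * D)) with hR
  refine ⟨ε / (16 * L * (|B| + 1)), by positivity, 2 * R * (A₀ + 1) + 1, ?_⟩
  intro T hT u v huv hB κ hκ y hy
  -- On intervals of length at most $2\eta$, the mean value theorem and the Lipschitz bound for
  -- determinants make the minors vary by at most $\kappa/8$. The constant `c` is chosen so that
  -- $c\kappa=\varepsilon\eta$.
  set η : ℝ := κ / (16 * L * (|B| + 1)) with hη
  have hη0 : 0 < η := by positivity
  -- Real parts suffice because $|t-\operatorname{Re}z|\le|t-z|$ for real $t$. All permutations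
  -- enter at once, since the permutation is chosen only later, interval by interval.
  set Z : Finset ℝ := Finset.univ.biUnion fun σ : Equiv.Perm (Fin d) =>
    (Finset.range (d + 1)).biUnion fun j =>
      ((wronskianDet (permutedDerivatives T σ) j).aroots ℂ).toFinset.image Complex.re with hZ
  have hZcard : Z.card ≤ R := by
    have h1 : Z.card ≤ (Finset.univ : Finset (Equiv.Perm (Fin d))).card *
        ((d + 1) * (d * D)) := by
      refine Finset.card_biUnion_le_card_mul _ _ _ fun σ _ => ?_
      have h2 := Finset.card_biUnion_le_card_mul (Finset.range (d + 1)) (fun j =>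
        ((wronskianDet (permutedDerivatives T σ) j).aroots ℂ).toFinset.image Complex.re) (d * D)
        fun j hj => by
          refine Finset.card_image_le.trans ((Multiset.toFinset_card_le _).trans ?_)
          refine (card_roots' _).trans ?_
          rw [natDegree_map]
          refine (natDegree_wronskianDet_le j (natDegree_permutedDerivatives_le hT σ)).trans ?_
          exact Nat.mul_le_mul_right _ (Nat.lt_succ_iff.1 (Finset.mem_range.1 hj))
      rwa [Finset.card_range] at h2
    rwa [Finset.card_univ, Fintype.card_perm, Fintype.card_fin] at h1
  have hm : v - u ≤ ε * η * (1 + ε) ^ (A₀ * y) := by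
    refine hy.trans ?_
    have h1 : (2 : ℝ) ^ y ≤ (1 + ε) ^ (A₀ * y) := by
      rw [pow_mul]
      exact pow_le_pow_left₀ (by norm_num) hA₀.le y
    have h2 : ε / (16 * L * (|B| + 1)) * κ = ε * η := by
      rw [hη]
      ring
    rw [h2]
    exact mul_le_mul_of_nonneg_left h1 (by positivity)
  obtain ⟨l, hl, hlen, hl'⟩ := exists_isPartition_whitney Z huv hη0 hε0 hm
  refine ⟨l, hl, ?_, ?_⟩
  · refine hlen.trans ?_
    calc Z.card * (2 * (A₀ * y + 1)) + 1 ≤ R * (2 * ((A₀ + 1) * (y + 1))) + 1 * (y + 1) := by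
          refine Nat.add_le_add (Nat.mul_le_mul hZcard (Nat.mul_le_mul_left _ ?_)) (by omega)
          nlinarith
      _ = (2 * R * (A₀ + 1) + 1) * (y + 1) := by ring
  intro I hI σ t ht hκt j hj1 hj s hs
  have hIm := hl.mem I hI
  by_cases hI2 : I.2 - I.1 ≤ 2 * η
  · have hent : ∀ (q p : Fin j) (x : ℝ), (derivative^[(q : ℕ)] (permutedDerivatives T σ p)).eval x =
        (derivative^[(q : ℕ) + 1] (T (σ (Fin.castLE hj p)))).eval x := by
      intro q p x
      rw [permutedDerivatives_apply T σ hj, Function.iterate_succ_apply]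
    have hsub : Icc I.1 I.2 ⊆ Icc u v := Icc_subset_Icc hIm.1 hIm.2.2
    have h1 : |mixedWronskian (permutedDerivatives T σ) j s -
        mixedWronskian (permutedDerivatives T σ) j fun _ => t| ≤ L * (|B| * (2 * η)) := by
      refine hL j hj _ _ _ (by positivity) (fun q p => ?_) (fun q p => ?_) (fun q p => ?_)
      · rw [Matrix.of_apply, hent]
        exact hB _ _ _ (hsub (hs q))
      · rw [Matrix.of_apply, hent]
        exact hB _ _ _ (hsub ht)
      · rw [Matrix.of_apply, Matrix.of_apply, hent, hent]
        have h2 := (convex_Icc I.1 I.2).norm_image_sub_le_of_norm_hasDerivWithin_le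
          (f := fun x => (derivative^[(q : ℕ) + 1] (T (σ (Fin.castLE hj p)))).eval x)
          (f' := fun x => (derivative^[(q : ℕ) + 1 + 1] (T (σ (Fin.castLE hj p)))).eval x)
          (C := |B|) (fun x _ => by
            rw [Function.iterate_succ_apply' _ ((q : ℕ) + 1)]
            exact (Polynomial.hasDerivAt _ x).hasDerivWithinAt)
          (fun x hx => (hB _ _ _ (hsub hx)).trans (le_abs_self B)) ht (hs q)
        refine h2.trans (mul_le_mul_of_nonneg_left ?_ (abs_nonneg _))
        rw [Real.norm_eq_abs, abs_le]
        have := hs q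
        constructor <;> linarith [this.1, this.2, ht.1, ht.2]
    refine h1.trans ?_
    have h3 : L * (|B| * (2 * η)) ≤ 1 / 8 * κ := by
      have h4 : L * ((|B| + 1) * (2 * η)) = 1 / 8 * κ := by
        rw [hη]
        field_simp
        norm_num
      rw [← h4]
      refine mul_le_mul_of_nonneg_left (mul_le_mul_of_nonneg_right ?_ (by positivity)) hL0.le
      linarith
    exact h3.trans (mul_le_mul_of_nonneg_left (hκt j hj1 hj) (by norm_num))
  · have hW := (hl' I hI).resolve_left hI2
    push Not at hI2
    -- With $\rho=|I|/\varepsilon$ the admissible distance $\varepsilon\rho$ is exactly the length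
    -- of $I$, and the Whitney property says that no zero is closer than $\rho$.
    refine hε _ (natDegree_permutedDerivatives_le hT σ) t ((I.2 - I.1) / ε)
      (div_pos (by linarith) hε0) ?_ j hj s ?_
    · intro j' hj' z hz
      -- The root multiset of the zero polynomial is empty by convention, so nonvanishing must be
      -- checked; it follows from the lower bound `κ` at `t`.
      have hne : wronskianDet (permutedDerivatives T σ) j' ≠ 0 := by
        intro h0
        rcases Nat.eq_zero_or_pos j' with h | h
        · rw [h, wronskianDet_zero] at h0
          exact one_ne_zero h0
        · have h5 := hκt j' h hj'
          rw [← eval_wronskianDet, h0, eval_zero, abs_zero] at h5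
          linarith
      have hzZ : z.re ∈ Z := by
        refine Finset.mem_biUnion.2 ⟨σ, Finset.mem_univ _, Finset.mem_biUnion.2
          ⟨j', Finset.mem_range.2 (by omega), Finset.mem_image.2 ⟨z, ?_, rfl⟩⟩⟩
        exact Multiset.mem_toFinset.2 (mem_aroots.2 ⟨hne, hz⟩)
      have h6 := hW _ hzZ t ht
      rw [div_le_iff₀ hε0, mul_comm]
      refine h6.trans (mul_le_mul_of_nonneg_left ?_ hε0.le)
      have h7 := Complex.abs_re_le_norm (z - t)
      rwa [Complex.sub_re, Complex.ofReal_re, abs_sub_comm] at h7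
    · intro q
      rw [mul_div_cancel₀ _ hε0.ne', abs_le]
      have := hs q
      constructor <;> linarith [this.1, this.2, ht.1, ht.2]

/-- The level sets of a polynomial at a multiple of `τ` partition an interval in pieces of small
oscillation. -/
theorem exists_isPartition_oscillation (P : ℝ[X]) {D : ℕ} (hP : P.natDegree ≤ D) (m : ℕ)
    {u v τ : ℝ} (huv : u ≤ v) (hτ : 0 < τ) :
    ∃ l, IsPartition u v l ∧ l.length ≤ (2 * m + 3) * D + 1 ∧
      ∀ I ∈ l, ∀ t ∈ Icc I.1 I.2, |P.eval t| ≤ m * τ → ∀ s ∈ Icc I.1 I.2,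
        |P.eval s - P.eval t| ≤ τ := by
  -- The levels extend one step beyond $\pm m\tau$, because from a value of modulus at most $m\tau$
  -- the next level may have index $\pm(m+1)$.
  set S : Finset ℝ := (Finset.Icc (-(m + 1) : ℤ) (m + 1)).biUnion fun i =>
    (P - C ((i : ℝ) * τ)).roots.toFinset with hS
  have hcard : S.card ≤ (2 * m + 3) * D := by
    have h1 := Finset.card_biUnion_le_card_mul (Finset.Icc (-(m + 1) : ℤ) (m + 1)) (fun i =>
      (P - C ((i : ℝ) * τ)).roots.toFinset) D fun i _ => by
        refine (Multiset.toFinset_card_le _).trans ((card_roots' _).trans ?_)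
        rwa [natDegree_sub_C]
    refine h1.trans (Nat.mul_le_mul_right _ ?_)
    rw [Int.card_Icc]
    omega
  obtain ⟨l, hl, hlen, hl'⟩ := exists_isPartition_of_finset S huv
  refine ⟨l, hl, by omega, fun I hI t ht htm s hs => ?_⟩
  have key : ∀ i : ℤ, -(m + 1) ≤ i → i ≤ m + 1 →
      ¬ (min (P.eval s) (P.eval t) < i * τ ∧ (i : ℝ) * τ < max (P.eval s) (P.eval t)) := by
    intro i hi1 hi2 hcon
    have hmem : (i : ℝ) * τ ∈ uIcc (P.eval s) (P.eval t) := ⟨hcon.1.le, hcon.2.le⟩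
    obtain ⟨x, hx, hxi⟩ := intermediate_value_uIcc
      (f := fun x => P.eval x) P.continuous.continuousOn hmem
    have hsx : x ≠ s := by
      rintro rfl
      rcases le_total (P.eval x) (P.eval t) with h | h
      · rw [min_eq_left h] at hcon
        exact hcon.1.ne hxi
      · rw [max_eq_left h] at hcon
        exact hcon.2.ne' hxi
    have htx : x ≠ t := by
      rintro rfl
      rcases le_total (P.eval s) (P.eval x) with h | h
      · rw [max_eq_right h] at hcon
        exact hcon.2.ne' hxi
      · rw [min_eq_right h] at hcon
        exact hcon.1.ne hxi
    have hxI : x ∈ Ioo I.1 I.2 := by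
      rcases le_total s t with h | h
      · rw [uIcc_of_le h] at hx
        exact ⟨hs.1.trans_lt (lt_of_le_of_ne hx.1 hsx.symm),
          (lt_of_le_of_ne hx.2 htx).trans_le ht.2⟩
      · rw [uIcc_of_ge h] at hx
        exact ⟨ht.1.trans_lt (lt_of_le_of_ne hx.1 htx.symm),
          (lt_of_le_of_ne hx.2 hsx).trans_le hs.2⟩
    refine hl' I hI x (Finset.mem_biUnion.2 ⟨i, Finset.mem_Icc.2 ⟨hi1, hi2⟩, ?_⟩) hxI
    rw [Multiset.mem_toFinset, mem_roots']
    -- If `P` were constant at this level its set of roots would be empty by convention, but then no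
    -- value lies strictly beyond the level.
    refine ⟨fun h0 => ?_, by simpa [sub_eq_zero] using hxi⟩
    have h1 : ∀ x, P.eval x = i * τ := fun x => by rw [sub_eq_zero.1 h0, eval_C]
    rw [h1, h1] at hcon
    simp at hcon
  -- A change by more than $\tau$ crosses a multiple of $\tau$ strictly, the one just above or just
  -- below `P.eval t`. By the intermediate value theorem this happens at an interior point, which
  -- contradicts the choice of the partition.
  by_contra hcon
  push Not at hcon
  have hx := Int.lt_floor_add_one (P.eval t / τ)
  have hx' := Int.floor_le (P.eval t / τ)
  have hy := Int.ceil_lt_add_one (P.eval t / τ)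
  have hy' := Int.le_ceil (P.eval t / τ)
  rw [div_lt_iff₀ hτ] at hx
  rw [le_div_iff₀ hτ] at hx'
  rw [← sub_lt_iff_lt_add, lt_div_iff₀ hτ] at hy
  rw [div_le_iff₀ hτ] at hy'
  rw [abs_le] at htm
  have hfl1 : (-(m : ℤ)) ≤ ⌊P.eval t / τ⌋ := by
    rw [Int.le_floor, le_div_iff₀ hτ]
    push_cast
    linarith
  have hfl2 : ⌊P.eval t / τ⌋ ≤ m := by
    refine Int.lt_add_one_iff.1 (Int.floor_lt.2 ?_)
    rw [div_lt_iff₀ hτ]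
    push_cast
    linarith
  have hcl1 : (-(m : ℤ)) ≤ ⌈P.eval t / τ⌉ := hfl1.trans (Int.floor_le_ceil _)
  have hcl2 : ⌈P.eval t / τ⌉ ≤ m := by
    rw [Int.ceil_le, div_le_iff₀ hτ]
    push_cast
    linarith
  rcases lt_abs.1 hcon with h | h
  · refine key (⌊P.eval t / τ⌋ + 1) (by omega) (by omega) ?_
    push_cast
    exact ⟨(min_le_right _ _).trans_lt hx, lt_of_lt_of_le (by linarith) (le_max_left _ _)⟩
  · refine key (⌈P.eval t / τ⌉ - 1) (by omega) (by omega) ?_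
    push_cast
    exact ⟨(min_le_left _ _).trans_lt (by linarith), lt_of_lt_of_le hy (le_max_right _ _)⟩

/-- The case distinction on the dimension saves a logarithm for curves on the line. -/
theorem exists_isPartition_mixedWronskian' (d D : ℕ) (B : ℝ) (Λ : ℕ) :
    ∃ c : ℝ, 0 < c ∧ ∃ A : ℕ, ∀ T : Fin d → ℝ[X], (∀ i, (T i).natDegree ≤ D) →
      ∀ u v : ℝ, u ≤ v → (∀ i q, ∀ s ∈ Icc u v, |(derivative^[q] (T i)).eval s| ≤ B) →
      ∀ κ : ℝ, 0 < κ → ∀ y : ℕ, v - u ≤ c * κ * 2 ^ y →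
      ∃ l, IsPartition u v l ∧ l.length ≤ A * (if d = 1 then 1 else y + 1) ∧
        ∀ I ∈ l, ∀ σ : Equiv.Perm (Fin d), ∀ t ∈ Icc I.1 I.2,
          (∀ j, 1 ≤ j → j ≤ d →
            κ ≤ |mixedWronskian (permutedDerivatives T σ) j fun _ => t|) →
          |mixedWronskian (permutedDerivatives T σ) d fun _ => t| ≤ Λ * κ →
          ∀ j, 1 ≤ j → j ≤ d → ∀ s : Fin j → ℝ, (∀ q, s q ∈ Icc I.1 I.2) →
            |mixedWronskian (permutedDerivatives T σ) j s -
              mixedWronskian (permutedDerivatives T σ) j fun _ => t| ≤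
              1 / 8 * |mixedWronskian (permutedDerivatives T σ) j fun _ => t| := by
  by_cases hd : d = 1
  · subst hd
    -- For $d=1$ the only minor is $T_0'$, of size at most $\Lambda\kappa$ where it matters. Levels
    -- spaced by $\kappa/8$ up to $8\Lambda$ steps suffice, and their number does not depend on `y`.
    refine ⟨1, one_pos, (2 * (8 * Λ) + 3) * D + 1, fun T hT u v huv _ κ hκ y _ => ?_⟩
    obtain ⟨l, hl, hlen, hl'⟩ := exists_isPartition_oscillation (derivative (T 0)) (D := D)
      ((natDegree_derivative_le _).trans ((Nat.sub_le _ _).trans (hT _))) (8 * Λ) huv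
      (τ := κ / 8) (by positivity)
    refine ⟨l, hl, by simpa using hlen, fun I hI σ t ht hκt hΛ j hj1 hj s hs => ?_⟩
    obtain rfl : j = 1 := le_antisymm hj hj1
    have hmix : ∀ s : Fin 1 → ℝ, mixedWronskian (permutedDerivatives T σ) 1 s =
        (derivative (T 0)).eval (s 0) := by
      intro s
      simp [mixedWronskian, permutedDerivatives, Subsingleton.elim (σ 0) 0]
    have h1 := hκt 1 le_rfl le_rfl
    rw [hmix] at hΛ h1 ⊢
    rw [hmix]
    refine (hl' I hI t ht (hΛ.trans (le_of_eq ?_)) _ (hs 0)).trans (by linarith)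
    push_cast
    ring
  · obtain ⟨c, hc, A, hA⟩ := exists_isPartition_mixedWronskian d D B
    refine ⟨c, hc, A, fun T hT u v huv hB κ hκ y hy => ?_⟩
    obtain ⟨l, hl, hlen, hl'⟩ := hA T hT u v huv hB κ hκ y hy
    refine ⟨l, hl, by rwa [if_neg hd], fun I hI σ t ht hκt _ => hl' I hI σ t ht hκt⟩

/-! ### Taylor approximation of the curve -/

theorem exists_derivative_eq (Q : ℝ[X]) {n : ℕ} (hQ : Q.natDegree ≤ n) (t x : ℝ) :
    ∃ P : ℝ[X], P.natDegree ≤ n + 1 ∧ derivative P = Q ∧ P.eval t = x := by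
  set R : ℝ[X] := ∑ i ∈ Finset.range (n + 1), monomial (i + 1) (Q.coeff i / (i + 1)) with hR
  have hdeg : R.natDegree ≤ n + 1 := by
    refine natDegree_sum_le_of_forall_le _ _ fun i hi => (natDegree_monomial_le _).trans ?_
    have := Finset.mem_range.1 hi
    omega
  have hder : derivative R = Q := by
    rw [hR, derivative_sum]
    conv_rhs => rw [Q.as_sum_range' (n + 1) (by omega)]
    refine Finset.sum_congr rfl fun i _ => ?_
    rw [derivative_monomial]
    push_cast
    rw [div_mul_cancel₀ _ (by positivity)]
  refine ⟨R + C (x - R.eval t), ?_, ?_, ?_⟩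
  · rw [natDegree_add_C]
    exact hdeg
  · rw [derivative_add, derivative_C, add_zero, hder]
  · simp

/-- Taylor approximation: a polynomial that approximates a function together with its
derivatives. -/
theorem exists_taylor_approximation (n : ℕ) {u v ω : ℝ} (huv : u ≤ v) (φ : ℕ → ℝ → ℝ)
    (hφ : ∀ i < n, ∀ s ∈ Icc u v, HasDerivWithinAt (φ i) (φ (i + 1) s) (Icc u v) s)
    (hω : ∀ s ∈ Icc u v, |φ n s - φ n u| ≤ ω) :
    ∃ P : ℝ[X], P.natDegree ≤ n ∧ ∀ i ≤ n, ∀ s ∈ Icc u v,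
      |φ i s - (derivative^[i] P).eval s| ≤ ω * (v - u) ^ (n - i) := by
  induction n generalizing φ with
  | zero =>
    refine ⟨C (φ 0 u), by simp, fun i hi s hs => ?_⟩
    obtain rfl : i = 0 := by omega
    simpa using hω s hs
  | succ n ih =>
    -- The derivative is approximated first. The primitive of its approximation that agrees with the
    -- function at `u` then gains one factor $v-u$ by the mean value inequality.
    obtain ⟨Q, hQ, hQ'⟩ := ih (fun i => φ (i + 1)) (fun i hi => hφ (i + 1) (by omega)) hω
    obtain ⟨P, hP, hPQ, hPu⟩ := exists_derivative_eq Q hQ u (φ 0 u)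
    have hu : u ∈ Icc u v := ⟨le_rfl, huv⟩
    refine ⟨P, hP, fun i hi s hs => ?_⟩
    cases i with
    | succ i =>
      rw [Function.iterate_succ_apply, hPQ, Nat.add_sub_add_right]
      exact hQ' i (by omega) s hs
    | zero =>
      have hω0 : 0 ≤ ω := (abs_nonneg _).trans (hω u hu)
      have h1 := (convex_Icc u v).norm_image_sub_le_of_norm_hasDerivWithin_le
        (f := fun x => φ 0 x - P.eval x) (f' := fun x => φ 1 x - Q.eval x)
        (C := ω * (v - u) ^ n) (fun x hx => by
          have h2 := (hφ 0 (by omega) x hx).sub (P.hasDerivAt x).hasDerivWithinAt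
          rwa [hPQ] at h2)
        (fun x hx => by simpa using hQ' 0 (Nat.zero_le _) x hx) hu hs
      simp only [hPu, sub_self, sub_zero, Real.norm_eq_abs] at h1
      rw [Function.iterate_zero, id, Nat.sub_zero, pow_succ, ← mul_assoc]
      refine h1.trans (mul_le_mul_of_nonneg_left ?_ ?_)
      · rw [abs_of_nonneg (by linarith [hs.1])]
        linarith [hs.2]
      · exact mul_nonneg hω0 (pow_nonneg (by linarith) _)

section Curve

variable {d : ℕ} {a b N : ℝ} {γ : ℝ → EuclideanSpace ℝ (Fin d)}

theorem hasDerivWithinAt_curveDeriv (hab : a < b) {n : ℕ} (hγ : ContDiffOn ℝ n γ (Icc a b))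
    {i : ℕ} (hi : i < n) {s : ℝ} (hs : s ∈ Icc a b) (p : Fin d) :
    HasDerivWithinAt (fun x => curveDeriv a b γ i x p) (curveDeriv a b γ (i + 1) s p)
      (Icc a b) s := by
  have hd : DifferentiableWithinAt ℝ (iteratedDerivWithin i γ (Icc a b)) (Icc a b) s :=
    hγ.differentiableOn_iteratedDerivWithin (by exact_mod_cast hi) (uniqueDiffOn_Icc hab) _ hs
  have h1 := hd.hasDerivWithinAt
  rw [← iteratedDerivWithin_succ] at h1
  exact (EuclideanSpace.proj (𝕜 := ℝ) p).hasFDerivAt.comp_hasDerivWithinAt s h1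

theorem exists_curveDeriv_bound (hab : a < b) {n : ℕ} (hγ : ContDiffOn ℝ n γ (Icc a b)) :
    ∃ G : ℝ, 0 ≤ G ∧ ∀ i ≤ n, ∀ s ∈ Icc a b, ‖curveDeriv a b γ i s‖ ≤ G := by
  have h : ∀ i ≤ n, ∃ G : ℝ, ∀ s ∈ Icc a b, ‖curveDeriv a b γ i s‖ ≤ G := fun i hi =>
    isCompact_Icc.exists_bound_of_continuousOn
      (hγ.continuousOn_iteratedDerivWithin (by exact_mod_cast hi) (uniqueDiffOn_Icc hab))
  choose! G hG using h
  refine ⟨∑ i ∈ Finset.range (n + 1), |G i|, Finset.sum_nonneg fun i _ => abs_nonneg _,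
    fun i hi s hs => (hG i hi s hs).trans ((le_abs_self _).trans ?_)⟩
  exact Finset.single_le_sum (f := fun i => |G i|) (fun i _ => abs_nonneg _)
    (Finset.mem_range.2 (by omega))

theorem norm_curveDeriv_le_curveNorm (hab : a < b) (hγ : ContDiffOn ℝ d γ (Icc a b)) {i : ℕ}
    (hi : i ≤ d) {s : ℝ} (hs : s ∈ Icc a b) : ‖curveDeriv a b γ i s‖ ≤ curveNorm a b γ := by
  obtain ⟨G, -, hG⟩ := exists_curveDeriv_bound hab hγ
  refine le_csSup ⟨G, ?_⟩ ⟨i, hi, s, hs, rfl⟩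
  rintro x ⟨i, hi, s, hs, rfl⟩
  exact hG i hi s hs

/-- Approximation of a curve of class `C^N` by polynomial curves on short intervals. -/
theorem IsCurveOfClass.exists_polynomial_approximation (hab : a < b) (hN : (d : ℝ) < N)
    (hγ : IsCurveOfClass N a b γ) :
    ∃ K B : ℝ, 0 < K ∧ 0 ≤ B ∧ ∀ u v : ℝ, a ≤ u → u ≤ v → v ≤ b →
      ∃ T : Fin d → ℝ[X], (∀ i, (T i).natDegree ≤ ⌊N⌋₊) ∧
        (∀ i q, ∀ s ∈ Icc u v, |(derivative^[q] (T i)).eval s| ≤ B) ∧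
        ∀ i, ∀ q ≤ d, ∀ s ∈ Icc u v,
          |curveDeriv a b γ q s i - (derivative^[q] (T i)).eval s| ≤ K * (v - u) ^ (N - d) := by
  obtain ⟨hγ, H, hH⟩ := hγ
  set n := ⌊N⌋₊ with hn
  have hN0 : 0 ≤ N := (Nat.cast_nonneg d).trans hN.le
  have hnN : (n : ℝ) ≤ N := Nat.floor_le hN0
  have hdn : d ≤ n := Nat.le_floor hN.le
  obtain ⟨G, hG0, hG⟩ := exists_curveDeriv_bound hab hγ
  have hba : 0 < b - a := by linarith
  set W : ℝ := max 1 (b - a) with hW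
  have hW1 : 1 ≤ W := le_max_left _ _
  set θ : ℝ := N - n with hθ
  have hθ0 : 0 ≤ θ := by simpa [hθ] using hnN
  refine ⟨(H + 1) * W ^ d, G + H * (b - a) ^ θ * W ^ n, by positivity, by positivity, ?_⟩
  intro u v hau huv hvb
  have hsub : Icc u v ⊆ Icc a b := Icc_subset_Icc hau hvb
  have huv0 : 0 ≤ v - u := by linarith
  have hcoord : ∀ (x : EuclideanSpace ℝ (Fin d)) (i : Fin d), |x i| ≤ ‖x‖ := fun x i => by
    simpa using PiLp.norm_apply_le x i
  have hhol : ∀ i : Fin d, ∀ s ∈ Icc u v,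
      |curveDeriv a b γ n s i - curveDeriv a b γ n u i| ≤ H * (v - u) ^ θ := by
    intro i s hs
    have h1 := hH.dist_le (hsub hs) (hsub ⟨le_rfl, huv⟩)
    rw [dist_eq_norm, Real.coe_toNNReal _ hθ0] at h1
    have h2 := hcoord (curveDeriv a b γ n s - curveDeriv a b γ n u) i
    refine h2.trans (h1.trans (mul_le_mul_of_nonneg_left ?_ H.2))
    refine Real.rpow_le_rpow dist_nonneg ?_ hθ0
    rw [Real.dist_eq, abs_of_nonneg (by linarith [hs.1])]
    linarith [hs.2]
  have hT : ∀ i : Fin d, ∃ P : ℝ[X], P.natDegree ≤ n ∧ ∀ q ≤ n, ∀ s ∈ Icc u v,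
      |curveDeriv a b γ q s i - (derivative^[q] P).eval s| ≤
        H * (v - u) ^ θ * (v - u) ^ (n - q) := fun i =>
    exists_taylor_approximation n huv (fun q s => curveDeriv a b γ q s i)
      (fun q hq s hs => (hasDerivWithinAt_curveDeriv hab hγ hq (hsub hs) i).mono hsub) (hhol i)
  choose T hTdeg hT using hT
  refine ⟨T, hTdeg, fun i q s hs => ?_, fun i q hq s hs => ?_⟩
  · rcases le_or_gt q n with hq | hq
    · have h1 := hT i q hq s hs
      have h2 := (hcoord (curveDeriv a b γ q s) i).trans (hG q hq s (hsub hs))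
      have h3 : (H : ℝ) * (v - u) ^ θ * (v - u) ^ (n - q) ≤ H * (b - a) ^ θ * W ^ n := by
        have e1 : (v - u) ^ θ ≤ (b - a) ^ θ := Real.rpow_le_rpow huv0 (by linarith) hθ0
        have e2 : (v - u) ^ (n - q) ≤ W ^ n :=
          (pow_le_pow_left₀ huv0 (by linarith [le_max_right 1 (b - a)]) _).trans
            (pow_le_pow_right₀ hW1 (Nat.sub_le _ _))
        gcongr
      rw [abs_le] at h1 h2 ⊢
      constructor <;> linarith [h1.1, h1.2, h2.1, h2.2]
    · rw [iterate_derivative_eq_zero ((hTdeg i).trans_lt hq), eval_zero, abs_zero]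
      positivity
  · refine (hT i q (hq.trans hdn) s hs).trans ?_
    have h1 : (v - u) ^ θ * (v - u) ^ (n - q) ≤ W ^ d * (v - u) ^ (N - d) := by
      -- Degenerate pieces are separate because $0^0=1$: for integral $N$ the Hölder factor does not
      -- vanish at $v=u$, but then $d<n$ and the power of order $n-q$ does.
      rcases eq_or_lt_of_le huv0 with h0 | h0
      · rw [← h0, Real.zero_rpow (by linarith : N - d ≠ 0), mul_zero]
        rcases eq_or_lt_of_le hθ0 with h0' | h0'
        · have h2 : d < n := by
            have : (d : ℝ) < n := by linarith
            exact_mod_cast this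
          rw [zero_pow (by omega), mul_zero]
        · rw [Real.zero_rpow h0'.ne', zero_mul]
      · rw [← Real.rpow_natCast, ← Real.rpow_add h0, Nat.cast_sub (hq.trans hdn)]
        have h2 : θ + ((n : ℝ) - q) = (d - q : ℕ) + (N - d) := by
          rw [Nat.cast_sub hq]
          ring
        rw [h2, Real.rpow_add h0, Real.rpow_natCast]
        refine mul_le_mul_of_nonneg_right ?_ (Real.rpow_nonneg huv0 _)
        exact (pow_le_pow_left₀ huv0 (by linarith [le_max_right 1 (b - a)]) _).trans
            (pow_le_pow_right₀ hW1 (Nat.sub_le _ _))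
    calc (H : ℝ) * (v - u) ^ θ * (v - u) ^ (n - q)
        = H * ((v - u) ^ θ * (v - u) ^ (n - q)) := by ring
      _ ≤ H * (W ^ d * (v - u) ^ (N - d)) := mul_le_mul_of_nonneg_left h1 H.2
      _ ≤ (H + 1) * (W ^ d * (v - u) ^ (N - d)) :=
          mul_le_mul_of_nonneg_right (by linarith)
            (mul_nonneg (by positivity) (Real.rpow_nonneg huv0 _))
      _ = (H + 1) * W ^ d * (v - u) ^ (N - d) := by ring

end Curve

/-! ### Multilinearity of minors and choice of the permutation -/

/-- The minor of the coordinates `σ 1, …, σ j` of the vectors `V 1, …, V j`. -/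
def vectorMinor {d j : ℕ} (σ : Equiv.Perm (Fin d)) (hj : j ≤ d)
    (V : Fin j → EuclideanSpace ℝ (Fin d)) : ℝ :=
  Matrix.det (Matrix.of fun q p : Fin j => V q (σ (Fin.castLE hj p)))

theorem torsionMinor_eq_vectorMinor {d j : ℕ} (D : ℕ → EuclideanSpace ℝ (Fin d))
    (σ : Equiv.Perm (Fin d)) (hj : j ≤ d) :
    torsionMinor D σ j hj = vectorMinor σ hj fun q => D (q + 1) := by
  rw [torsionMinor, vectorMinor, ← Matrix.det_transpose]
  rfl

theorem vectorMinor_average {d j m : ℕ} (σ : Equiv.Perm (Fin d)) (hj : j ≤ d)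
    (V : Fin j → Fin m → EuclideanSpace ℝ (Fin d)) :
    vectorMinor σ hj (fun q => (m : ℝ)⁻¹ • ∑ k, V q k) =
      ((m : ℝ)⁻¹) ^ j * ∑ r : Fin j → Fin m, vectorMinor σ hj fun q => V q (r q) := by
  have h1 : (Matrix.of fun q p : Fin j => ((m : ℝ)⁻¹ • ∑ k, V q k) (σ (Fin.castLE hj p))) =
      (m : ℝ)⁻¹ • Matrix.of fun q p : Fin j => ∑ k, V q k (σ (Fin.castLE hj p)) := by
    ext q p
    simp
  rw [vectorMinor, h1, Matrix.det_smul, Fintype.card_fin]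
  congr 1
  have h2 := (Matrix.detRowAlternating (R := ℝ) (n := Fin j)).toMultilinearMap.map_sum
    (fun (q : Fin j) (k : Fin m) (p : Fin j) => V q k (σ (Fin.castLE hj p)))
  refine Eq.trans (congrArg Matrix.det (Matrix.ext fun q p => ?_)) h2
  simp

/-- Deviations from `x` may be averaged over the $m^j$ choices of one point per row, so the bound
`e` does not deteriorate with $m$. This is what makes the estimates uniform over offspring curves.
-/
theorem abs_vectorMinor_average_sub_le {d j m : ℕ} (hm : 1 ≤ m) (σ : Equiv.Perm (Fin d))
    (hj : j ≤ d) (V : Fin j → Fin m → EuclideanSpace ℝ (Fin d)) {x e : ℝ}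
    (h : ∀ r : Fin j → Fin m, |vectorMinor σ hj (fun q => V q (r q)) - x| ≤ e) :
    |vectorMinor σ hj (fun q => (m : ℝ)⁻¹ • ∑ k, V q k) - x| ≤ e := by
  have hm0 : (m : ℝ) ^ j ≠ 0 := pow_ne_zero _ (by exact_mod_cast (by omega : m ≠ 0))
  have hm1 : 0 < (m : ℝ) ^ j := by positivity
  have hcard : (Finset.univ : Finset (Fin j → Fin m)).card = m ^ j := by simp
  have h1 : vectorMinor σ hj (fun q => (m : ℝ)⁻¹ • ∑ k, V q k) - x =
      ((m : ℝ) ^ j)⁻¹ * ∑ r : Fin j → Fin m, (vectorMinor σ hj (fun q => V q (r q)) - x) := by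
    rw [vectorMinor_average, Finset.sum_sub_distrib, Finset.sum_const, hcard, nsmul_eq_mul,
      mul_sub, inv_pow]
    push_cast
    rw [inv_mul_cancel_left₀ hm0]
  rw [h1, abs_mul, abs_inv, abs_of_pos hm1, inv_mul_le_iff₀ hm1]
  refine (Finset.abs_sum_le_sum_abs _ _).trans ?_
  refine (Finset.sum_le_card_nsmul _ _ _ fun r _ => h r).trans ?_
  rw [hcard, nsmul_eq_mul]
  push_cast
  exact le_rfl

/-- The rows of a matrix may be ordered such that all leading minors are controlled from below by
the determinant. -/
theorem exists_perm_abs_det_le {n : ℕ} (A : Matrix (Fin n) (Fin n) ℝ) {G : ℝ} (hG : 0 ≤ G)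
    (hA : ∀ i q, |A i q| ≤ G) :
    ∃ σ : Equiv.Perm (Fin n), ∀ j, ∀ hj : j ≤ n,
      |A.det| * j.factorial ≤ n.factorial * G ^ (n - j) *
        |(Matrix.of fun q p : Fin j => A (σ (Fin.castLE hj p)) (Fin.castLE hj q)).det| := by
  induction n with
  | zero =>
    refine ⟨1, fun j hj => ?_⟩
    obtain rfl : j = 0 := by omega
    simp
  | succ n ih =>
    set m : Fin (n + 1) → ℝ := fun i => (A.submatrix i.succAbove Fin.castSucc).det with hm
    -- The row whose cofactor is largest is put last. One expansion costs a factor $(n+1)G$, and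
    -- these factors accumulate to $n!\,G^{n-j}/j!$.
    obtain ⟨i, -, hi⟩ := Finset.exists_max_image Finset.univ (fun i => |m i|)
      ⟨0, Finset.mem_univ _⟩
    obtain ⟨σ', hσ'⟩ := ih (A.submatrix i.succAbove Fin.castSucc) fun i q => hA _ _
    have hdet : |A.det| ≤ (n + 1) * (G * |m i|) := by
      rw [Matrix.det_succ_column A (Fin.last n)]
      refine (Finset.abs_sum_le_sum_abs _ _).trans ?_
      refine (Finset.sum_le_card_nsmul _ _ (G * |m i|) fun i' _ => ?_).trans ?_
      · rw [abs_mul, abs_mul, abs_pow, abs_neg, abs_one, one_pow, one_mul, Fin.succAbove_last]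
        exact mul_le_mul (hA _ _) (hi i' (Finset.mem_univ _)) (abs_nonneg _) hG
      · simp
    set σ : Equiv.Perm (Fin (n + 1)) :=
      (finSuccEquiv' (Fin.last n)).trans (σ'.optionCongr.trans (finSuccEquiv' i).symm) with hσ
    have hσc : ∀ x : Fin n, σ x.castSucc = i.succAbove (σ' x) := by
      intro x
      simp [hσ, finSuccEquiv'_last_apply_castSucc]
    refine ⟨σ, fun j hj => ?_⟩
    rcases Nat.lt_or_ge n j with hnj | hnj
    · obtain rfl : j = n + 1 := by omega
      have h1 : (Matrix.of fun q p : Fin (n + 1) => A (σ (Fin.castLE hj p)) (Fin.castLE hj q)) =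
          (A.submatrix σ id).transpose := rfl
      rw [h1, Matrix.det_transpose, Matrix.det_permute, abs_mul]
      rcases Int.units_eq_one_or (Equiv.Perm.sign σ) with h | h <;> simp [h, mul_comm]
    · have h2 := hσ' j hnj
      have h3 : (Matrix.of fun q p : Fin j => A (σ (Fin.castLE hj p)) (Fin.castLE hj q)) =
          Matrix.of fun q p : Fin j => A.submatrix i.succAbove Fin.castSucc
            (σ' (Fin.castLE hnj p)) (Fin.castLE hnj q) := by
        ext q p
        simp only [Matrix.of_apply, Matrix.submatrix_apply]
        rw [← hσc]
        rfl
      rw [h3, Nat.succ_sub hnj, pow_succ, Nat.factorial_succ]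
      push_cast
      calc |A.det| * j.factorial ≤ (n + 1) * (G * |m i|) * j.factorial :=
            mul_le_mul_of_nonneg_right hdet (by positivity)
        _ = (n + 1) * G * (|m i| * j.factorial) := by ring
        _ ≤ (n + 1) * G * _ := mul_le_mul_of_nonneg_left h2 (by positivity)
        _ = _ := by ring

theorem abs_torsionMinor_perm {d : ℕ} (D : ℕ → EuclideanSpace ℝ (Fin d))
    (σ : Equiv.Perm (Fin d)) :
    |torsionMinor D σ d le_rfl| = |torsionMinor D 1 d le_rfl| := by
  have h1 : (Matrix.of fun p q : Fin d => D ((q : ℕ) + 1) (σ (Fin.castLE le_rfl p))) =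
      (Matrix.of fun p q : Fin d => D ((q : ℕ) + 1)
        ((1 : Equiv.Perm (Fin d)) (Fin.castLE le_rfl p))).submatrix σ id := rfl
  rw [torsionMinor, h1, Matrix.det_permute, abs_mul]
  rcases Int.units_eq_one_or (Equiv.Perm.sign σ) with h | h <;> simp [h, torsionMinor]

theorem abs_torsionMinor_le {d : ℕ} {D : ℕ → EuclideanSpace ℝ (Fin d)} {G : ℝ}
    (hD : ∀ q ≤ d, ‖D q‖ ≤ G) (σ : Equiv.Perm (Fin d)) {j : ℕ} (hj : j ≤ d) :
    |torsionMinor D σ j hj| ≤ j.factorial * G ^ j := by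
  have h := Matrix.det_le (abv := AbsoluteValue.abs) (x := G)
    (A := Matrix.of fun p q : Fin j => D ((q : ℕ) + 1) (σ (Fin.castLE hj p))) fun p q => by
      refine le_trans ?_ (hD ((q : ℕ) + 1) (by omega))
      simpa using PiLp.norm_apply_le (D ((q : ℕ) + 1)) (σ (Fin.castLE hj p))
  simpa [torsionMinor] using h

/-- At each point where the torsion has size `2^{-k}`, the coordinates may be permuted so that all
the minors are bounded below in terms of `2^{-k}`. -/
theorem exists_perm_torsionMinor {d : ℕ} {D : ℕ → EuclideanSpace ℝ (Fin d)} {G : ℝ}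
    (hG : 0 < G) (hD : ∀ q ≤ d, ‖D q‖ ≤ G) (kd : ℤ)
    (h1 : (2 : ℝ) ^ (-kd - 1) ≤ |torsionMinor D 1 d le_rfl|)
    (h2 : |torsionMinor D 1 d le_rfl| ≤ (2 : ℝ) ^ (-kd)) :
    ∃ (σ : Equiv.Perm (Fin d)) (k : ℕ → ℤ), k d = kd ∧ ∀ j, ∀ hj : j ≤ d,
      (2 : ℝ) ^ (-k j - 1) ≤ |torsionMinor D σ j hj| ∧
      |torsionMinor D σ j hj| ≤ (2 : ℝ) ^ (-k j) ∧
      (2 : ℝ) ^ (-kd - 1) ≤ d.factorial * (1 + G) ^ d * |torsionMinor D σ j hj| ∧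
      -1 - Real.logb 2 (j.factorial * G ^ j) ≤ k j ∧
      (k j : ℝ) ≤ kd + (-1 - Real.logb 2 (j.factorial * G ^ j)) +
        Real.logb 2 (d.factorial * G ^ d) + 2 := by
  obtain ⟨σ, hσ⟩ := exists_perm_abs_det_le
    (Matrix.of fun p q : Fin d => D ((q : ℕ) + 1) p) hG.le fun p q => by
      refine le_trans ?_ (hD ((q : ℕ) + 1) (by omega))
      simpa using PiLp.norm_apply_le (D ((q : ℕ) + 1)) p
  have hdet : (Matrix.of fun p q : Fin d => D ((q : ℕ) + 1) p).det =
      torsionMinor D 1 d le_rfl := rfl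
  have hmin : ∀ j, ∀ hj : j ≤ d, (Matrix.of fun q p : Fin j =>
      (Matrix.of fun p q : Fin d => D ((q : ℕ) + 1) p) (σ (Fin.castLE hj p)) (Fin.castLE hj q)).det =
      torsionMinor D σ j hj := by
    intro j hj
    rw [torsionMinor, ← Matrix.det_transpose]
    rfl
  have hlow : ∀ j, ∀ hj : j ≤ d, (2 : ℝ) ^ (-kd - 1) * j.factorial ≤
      d.factorial * G ^ (d - j) * |torsionMinor D σ j hj| := by
    intro j hj
    have h3 := hσ j hj
    rw [hmin, hdet] at h3
    exact (mul_le_mul_of_nonneg_right h1 (by positivity)).trans h3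
  have hpow0 : (0 : ℝ) < (2 : ℝ) ^ (-kd - 1) := by positivity
  have hpos : ∀ j, ∀ hj : j ≤ d, 0 < |torsionMinor D σ j hj| := by
    intro j hj
    rcases (abs_nonneg (torsionMinor D σ j hj)).eq_or_lt with h0 | h0
    · have h3 := hlow j hj
      rw [← h0, mul_zero] at h3
      exact absurd h3 (not_le.2 (by positivity))
    · exact h0
  have hk : ∀ j, ∃ k : ℤ, (j = d → k = kd) ∧ ∀ hj : j ≤ d,
      (2 : ℝ) ^ (-k - 1) ≤ |torsionMinor D σ j hj| ∧ |torsionMinor D σ j hj| ≤ (2 : ℝ) ^ (-k) := by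
    intro j
    -- The full minor keeps the prescribed exponent: at the endpoint value $2^{-k_d-1}$ the
    -- half-open dyadic choice used for the other minors would return $k_d+1$.
    by_cases hjd : j = d
    · subst hjd
      refine ⟨kd, fun _ => rfl, fun hj => ?_⟩
      rw [abs_torsionMinor_perm]
      exact ⟨h1, h2⟩
    by_cases hj : j ≤ d
    · obtain ⟨n, hn⟩ := exists_mem_Ioc_zpow (hpos j hj) (one_lt_two : (1 : ℝ) < 2)
      refine ⟨-(n + 1), fun h => absurd h hjd, fun _ => ?_⟩
      rw [show - -(n + 1) - 1 = n by ring, neg_neg]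
      exact ⟨hn.1.le, hn.2⟩
    · exact ⟨0, fun h => absurd h hjd, fun h => absurd h hj⟩
  choose k hkd hk using hk
  refine ⟨σ, k, hkd d rfl, fun j hj => ⟨(hk j hj).1, (hk j hj).2, ?_, ?_, ?_⟩⟩
  · have h3 := hlow j hj
    have h4 : (1 : ℝ) ≤ j.factorial := by exact_mod_cast Nat.succ_le_of_lt (Nat.factorial_pos j)
    have h5 : G ^ (d - j) ≤ (1 + G) ^ d :=
      (pow_le_pow_left₀ hG.le (by linarith) _).trans
        (pow_le_pow_right₀ (by linarith) (Nat.sub_le _ _))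
    calc (2 : ℝ) ^ (-kd - 1) ≤ (2 : ℝ) ^ (-kd - 1) * j.factorial :=
          le_mul_of_one_le_right hpow0.le h4
      _ ≤ _ := h3
      _ ≤ _ := mul_le_mul_of_nonneg_right (mul_le_mul_of_nonneg_left h5 (by positivity))
          (abs_nonneg _)
  · have h3 : -(k j : ℝ) - 1 ≤ Real.logb 2 (j.factorial * G ^ j) := by
      rw [Real.le_logb_iff_rpow_le one_lt_two (by positivity)]
      have h4 := (hk j hj).1.trans (abs_torsionMinor_le hD σ hj)
      rw [← Real.rpow_intCast] at h4
      push_cast at h4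
      exact h4
    linarith
  · have h3 := (hlow j hj).trans (mul_le_mul_of_nonneg_left (hk j hj).2 (by positivity))
    -- Multiplication by $G^j$ completes $G^{d-j}$ to $G^d$; taking logarithms then gives the upper
    -- bound for `k j`.
    have h4 := mul_le_mul_of_nonneg_right h3 (pow_nonneg hG.le j)
    have h5 : (d.factorial : ℝ) * G ^ (d - j) * (2 : ℝ) ^ (-k j) * G ^ j =
        d.factorial * G ^ d * (2 : ℝ) ^ (-k j) := by
      rw [← Nat.sub_add_cancel hj, pow_add, Nat.sub_add_cancel hj]
      ring
    rw [h5, mul_assoc] at h4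
    have h6 := Real.logb_le_logb_of_le one_lt_two (by positivity) h4
    have hl : ∀ z : ℤ, Real.logb 2 ((2 : ℝ) ^ z) = z := fun z => by
      rw [← Real.rpow_intCast, Real.logb_rpow (by norm_num) (by norm_num)]
    rw [Real.logb_mul (by positivity) (by positivity),
      Real.logb_mul (x := (d.factorial : ℝ) * G ^ d) (by positivity) (by positivity), hl, hl] at h6
    push_cast at h6
    linarith

/-! ### Stable intervals -/

/-- On the interval `I` all mixed minors are comparable to the minors at a point of `I` where the
minors are bounded below by `c 2^{-k}`. -/
def IsStable {d : ℕ} (a b : ℝ) (γ : ℝ → EuclideanSpace ℝ (Fin d)) (c : ℝ) (k : ℤ) (I : ℝ × ℝ) :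
    Prop :=
  ∀ σ : Equiv.Perm (Fin d), ∀ t ∈ Icc I.1 I.2,
    (∀ j, 1 ≤ j → ∀ hj : j ≤ d, c * (2 : ℝ) ^ (-k) ≤ |curveMinor a b γ σ j hj t|) →
    |curveMinor a b γ σ d le_rfl t| ≤ (2 : ℝ) ^ (-k) →
    ∀ j, 1 ≤ j → ∀ hj : j ≤ d, ∀ s : Fin j → ℝ, (∀ q, s q ∈ Icc I.1 I.2) →
      |vectorMinor σ hj (fun q => curveDeriv a b γ (q + 1) (s q)) - curveMinor a b γ σ j hj t| ≤
        1 / 4 * |curveMinor a b γ σ j hj t|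

variable {d : ℕ} {a b N : ℝ} {γ : ℝ → EuclideanSpace ℝ (Fin d)}

/-- Partition of a short interval into stable intervals. -/
theorem IsCurveOfClass.exists_isPartition_short (hab : a < b) (hN : (d : ℝ) < N)
    (hγ : IsCurveOfClass N a b γ) {c : ℝ} (hc : 0 < c) :
    ∃ c₁ c₂ : ℝ, 0 < c₁ ∧ 0 < c₂ ∧ ∃ A : ℕ, ∀ (k : ℤ) (y : ℕ) (u v : ℝ), a ≤ u → u ≤ v → v ≤ b →
      (v - u) ^ (N - d) ≤ c₁ * (2 : ℝ) ^ (-k) → v - u ≤ c₂ * (2 : ℝ) ^ (-k) * 2 ^ y →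
      ∃ l, IsPartition u v l ∧ l.length ≤ A * (if d = 1 then 1 else y + 1) ∧
        ∀ I ∈ l, IsStable a b γ c k I := by
  obtain ⟨K, B, hK0, hB0, hT⟩ := hγ.exists_polynomial_approximation hab hN
  have hdn : d ≤ ⌊N⌋₊ := Nat.le_floor hN.le
  obtain ⟨G, hG0, hG⟩ := exists_curveDeriv_bound hab hγ.1
  obtain ⟨L, hL0, hL⟩ := exists_abs_det_sub_det_le d (max B G)
  -- The polynomial minor of order $d$ is at most $(1+c)2^{-k}$, which is to be at most
  -- $\Lambda\kappa$ with $\kappa=\frac c2 2^{-k}$.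
  obtain ⟨Λ, hΛ⟩ := exists_nat_ge (2 * (1 + c) / c)
  obtain ⟨c₂, hc₂, A, hA⟩ := exists_isPartition_mixedWronskian' d ⌊N⌋₊ B Λ
  refine ⟨c / (32 * L * K), c₂ * (c / 2), by positivity, by positivity, A, ?_⟩
  intro k y u v hau huv hvb hδ hy
  obtain ⟨T, hTdeg, hTB, hTγ⟩ := hT u v hau huv hvb
  have h2k : (0 : ℝ) < (2 : ℝ) ^ (-k) := by positivity
  obtain ⟨l, hl, hlen, hl'⟩ := hA T hTdeg u v huv hTB (c / 2 * (2 : ℝ) ^ (-k)) (by positivity) y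
    (by linarith)
  refine ⟨l, hl, hlen, fun I hI σ t ht hlow hup j hj1 hj s hs => ?_⟩
  have hIm := hl.mem I hI
  have hsub : Icc I.1 I.2 ⊆ Icc u v := Icc_subset_Icc hIm.1 hIm.2.2
  have hsub' : Icc u v ⊆ Icc a b := Icc_subset_Icc hau hvb
  -- The unit of error: replacing the curve by polynomials costs `e`, the curve minors are at least
  -- $32e$, and $\kappa=16e$. The total $e+\frac18(x+e)+e$ is at most $\frac x4$ when $x\ge32e$.
  set e : ℝ := c / 32 * (2 : ℝ) ^ (-k) with he
  have he0 : 0 < e := by positivity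
  have hKL : L * (K * (v - u) ^ (N - d)) ≤ e := by
    calc L * (K * (v - u) ^ (N - d)) ≤ L * (K * (c / (32 * L * K) * (2 : ℝ) ^ (-k))) := by gcongr
      _ = e := by
        rw [he]
        field_simp
  have happ : ∀ j, ∀ hj : j ≤ d, ∀ s : Fin j → ℝ, (∀ q, s q ∈ Icc I.1 I.2) →
      |vectorMinor σ hj (fun q => curveDeriv a b γ (q + 1) (s q)) -
        mixedWronskian (permutedDerivatives T σ) j s| ≤ e := by
    intro j hj s hs
    refine le_trans ?_ hKL
    have hent : ∀ q p : Fin j, (derivative^[(q : ℕ)] (permutedDerivatives T σ p)).eval (s q) =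
        (derivative^[(q : ℕ) + 1] (T (σ (Fin.castLE hj p)))).eval (s q) := by
      intro q p
      rw [permutedDerivatives_apply T σ hj, Function.iterate_succ_apply]
    refine hL j hj _ _ _ (mul_nonneg hK0.le (Real.rpow_nonneg (by linarith) _))
      (fun q p => ?_) (fun q p => ?_) (fun q p => ?_)
    · rw [Matrix.of_apply]
      have h1 : |curveDeriv a b γ (q + 1) (s q) (σ (Fin.castLE hj p))| ≤
          ‖curveDeriv a b γ (q + 1) (s q)‖ := by
        simpa using PiLp.norm_apply_le (curveDeriv a b γ (q + 1) (s q)) (σ (Fin.castLE hj p))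
      exact (h1.trans (hG _ (by omega) _ (hsub' (hsub (hs q))))).trans (le_max_right _ _)
    · rw [Matrix.of_apply, hent]
      exact (hTB _ _ _ (hsub (hs q))).trans (le_max_left _ _)
    · rw [Matrix.of_apply, Matrix.of_apply, hent]
      exact hTγ _ _ (by omega) _ (hsub (hs q))
  have happt : ∀ j, ∀ hj : j ≤ d, |curveMinor a b γ σ j hj t -
      mixedWronskian (permutedDerivatives T σ) j fun _ => t| ≤ e := by
    intro j hj
    rw [curveMinor, torsionMinor_eq_vectorMinor]
    exact happ j hj (fun _ => t) fun _ => ht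
  have h16 : c / 2 * (2 : ℝ) ^ (-k) = 16 * e := by
    rw [he]
    ring
  have h32 : c * (2 : ℝ) ^ (-k) = 32 * e := by
    rw [he]
    ring
  rw [h16] at hl'
  rw [h32] at hlow
  have htri : ∀ x y z : ℝ, |x - y| ≤ z → |x| ≤ |y| + z ∧ |y| ≤ |x| + z := fun x y z h => by
    have h1 := abs_sub_abs_le_abs_sub x y
    have h2 := abs_sub_abs_le_abs_sub y x
    rw [abs_sub_comm y x] at h2
    exact ⟨by linarith, by linarith⟩
  have hmain := hl' I hI σ t ht (fun j hj1 hj => by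
      have h1 := hlow j hj1 hj
      have h2 := (htri _ _ _ (happt j hj)).1
      linarith) (by
      have h2 := (htri _ _ _ (happt d le_rfl)).2
      have h3 : (1 + c) * (2 : ℝ) ^ (-k) ≤ Λ * (16 * e) := by
        rw [← h16, ← mul_assoc]
        refine mul_le_mul_of_nonneg_right ?_ h2k.le
        rw [div_le_iff₀ hc] at hΛ
        linarith
      have h4 : e ≤ c * (2 : ℝ) ^ (-k) := by linarith
      linarith) j hj1 hj s hs
  have h1 := happ j hj s hs
  have h2 := happt j hj
  have h3 := (htri _ _ _ h2).2
  have h4 := hlow j hj1 hj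
  have h5 := abs_sub_le (vectorMinor σ hj (fun q => curveDeriv a b γ (q + 1) (s q)))
    (mixedWronskian (permutedDerivatives T σ) j s) (curveMinor a b γ σ j hj t)
  have h6 := abs_sub_le (mixedWronskian (permutedDerivatives T σ) j s)
    (mixedWronskian (permutedDerivatives T σ) j fun _ => t) (curveMinor a b γ σ j hj t)
  rw [abs_sub_comm (mixedWronskian (permutedDerivatives T σ) j fun _ => t)] at h6
  linarith

theorem exists_isPartition_of_pieces (Q : ℝ × ℝ → Prop) {δ u₀ v : ℝ} (hδ : 0 ≤ δ) (K : ℕ)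
    (h : ∀ u w, u₀ ≤ u → u ≤ w → w ≤ v → w - u ≤ δ →
      ∃ l, IsPartition u w l ∧ l.length ≤ K ∧ ∀ I ∈ l, Q I) (M : ℕ) :
    ∀ u, u₀ ≤ u → u ≤ v → v - u ≤ (M + 1) * δ →
      ∃ l, IsPartition u v l ∧ l.length ≤ (M + 1) * K ∧ ∀ I ∈ l, Q I := by
  induction M with
  | zero =>
    intro u hu huv hδv
    obtain ⟨l, hl⟩ := h u v hu huv le_rfl (by simpa using hδv)
    exact ⟨l, by simpa using hl⟩
  | succ M ih =>
    intro u hu huv hδv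
    have hw1 : u ≤ min (u + δ) v := le_min (by linarith) huv
    have hw2 : min (u + δ) v ≤ v := min_le_right _ _
    have hw3 : v - min (u + δ) v ≤ (M + 1) * δ := by
      push_cast at hδv
      rcases min_cases (u + δ) v with hm | hm
      · rw [hm.1]
        linarith
      · rw [hm.1, sub_self]
        positivity
    obtain ⟨l₁, hp₁, hl₁, hQ₁⟩ := h u (min (u + δ) v) hu hw1 hw2
      (by linarith [min_le_left (u + δ) v])
    obtain ⟨l₂, hp₂, hl₂, hQ₂⟩ := ih (min (u + δ) v) (hu.trans hw1) hw2 hw3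
    refine ⟨l₁ ++ l₂, hp₁.append hp₂ hw1 hw2, ?_, ?_⟩
    · rw [List.length_append]
      calc l₁.length + l₂.length ≤ K + (M + 1) * K := Nat.add_le_add hl₁ hl₂
        _ = (M + 1 + 1) * K := by ring
    · intro I hI
      rcases List.mem_append.1 hI with hI | hI
      · exact hQ₁ I hI
      · exact hQ₂ I hI

/-- In dimension at least two a logarithmic factor is absorbed by the exponents of the lower
minors. -/
theorem exists_factor_le_rpow (hN : (d : ℝ) < N) (hd : 1 ≤ d) (c : ℝ) :
    ∃ C : ℝ, 0 < C ∧ ∀ k : ℤ, 1 ≤ (k : ℝ) + c →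
      (if d = 1 then 1 else (k : ℝ) + c) * (2 : ℝ) ^ ((k : ℝ) * (1 / (N - d))) ≤
        C * (2 : ℝ) ^ ((k : ℝ) * decompositionExponent d N) := by
  obtain ⟨n, rfl⟩ : ∃ n, d = n + 1 := ⟨d - 1, by omega⟩
  set S : ℝ := ∑ j ∈ Finset.Icc 1 n, 1 / (N - j) with hS
  have hexp : decompositionExponent (n + 1) N = S + 1 / (N - ((n + 1 : ℕ) : ℝ)) := by
    rw [decompositionExponent, Finset.sum_Icc_succ_top (by omega)]
  rw [hexp]
  rcases Nat.eq_zero_or_pos n with rfl | hn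
  · exact ⟨1, one_pos, fun k _ => by simp [hS]⟩
  have hS0 : 0 < S := by
    refine Finset.sum_pos (fun j hj => ?_) ⟨1, Finset.mem_Icc.2 ⟨le_rfl, hn⟩⟩
    have h1 : (j : ℝ) ≤ n := by exact_mod_cast (Finset.mem_Icc.1 hj).2
    push_cast at hN
    exact one_div_pos.2 (by linarith)
  have hlog : 0 < Real.log 2 := Real.log_pos one_lt_two
  refine ⟨(2 : ℝ) ^ (c * S) / (Real.log 2 * S), by positivity, fun k hk => ?_⟩
  rw [if_neg (by omega), mul_add, Real.rpow_add two_pos, ← mul_assoc]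
  refine mul_le_mul_of_nonneg_right ?_ (by positivity)
  have h1 : (2 : ℝ) ^ (c * S) / (Real.log 2 * S) * (2 : ℝ) ^ ((k : ℝ) * S) =
      (2 : ℝ) ^ (((k : ℝ) + c) * S) / (Real.log 2 * S) := by
    rw [add_mul, Real.rpow_add two_pos]
    ring
  rw [h1, le_div_iff₀ (by positivity), Real.rpow_def_of_pos two_pos]
  -- The logarithmic factor $k+c$ is linear, hence dominated by the exponential with rate
  -- $S\log2>0$, which the lower minors provide.
  have h2 := Real.add_one_le_exp (Real.log 2 * (((k : ℝ) + c) * S))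
  linarith

/-- Partition of the whole interval into stable intervals. -/
theorem IsCurveOfClass.exists_isPartition (hd : 1 ≤ d) (hab : a < b) (hN : (d : ℝ) < N)
    (hγ : IsCurveOfClass N a b γ) {c : ℝ} (hc : 0 < c) {Cγ : ℝ} (hCγ : 0 < Cγ) :
    ∃ C : ℝ, 0 < C ∧ ∀ k : ℤ, 1 ≤ (k : ℝ) + Cγ →
      ∃ l, IsPartition a b l ∧
        (l.length : ℝ) ≤ C * (2 : ℝ) ^ ((k : ℝ) * decompositionExponent d N) ∧
        ∀ I ∈ l, IsStable a b γ c k I := by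
  obtain ⟨c₁, c₂, hc₁, hc₂, A, hA⟩ := hγ.exists_isPartition_short hab hN hc
  obtain ⟨C₀, hC₀, hC₀'⟩ := exists_factor_le_rpow hN hd Cγ
  obtain ⟨Y, hY⟩ := pow_unbounded_of_one_lt ((b - a) / c₂) one_lt_two
  have hNd : 0 < N - d := by linarith
  have hba : 0 < b - a := by linarith
  set r : ℝ := 1 / (N - d) with hr
  have hr0 : 0 < r := one_div_pos.2 hNd
  set X₀ : ℝ := (b - a) * c₁⁻¹ ^ r with hX₀
  have hX₀0 : 0 < X₀ := by positivity
  refine ⟨(X₀ + (2 : ℝ) ^ (Cγ * r)) * (A + 1) * (Y + 2) * C₀, by positivity, fun k hk => ?_⟩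
  set E : ℝ := (2 : ℝ) ^ ((k : ℝ) * r) with hE
  have hE0 : 0 < E := by positivity
  set X : ℝ := X₀ * E with hX
  have hX0 : 0 < X := by positivity
  set M : ℕ := ⌊X⌋₊ with hM
  -- `X` is arranged so that $\delta^{N-d}=c_1 2^{-k}$, the longest pieces for which the Taylor
  -- error is admissible.
  set δ : ℝ := (b - a) / X with hδ
  have hδ0 : 0 < δ := by positivity
  -- The integer $k+Y$ may be negative; truncation at $0$ only enlarges $2^y$, and the comparison
  -- with $k+C_\gamma\ge1$ survives.
  set y : ℕ := (k + Y).toNat with hy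
  have h2k : (0 : ℝ) < (2 : ℝ) ^ (-k) := by positivity
  have hδ1 : δ ^ (N - d) ≤ c₁ * (2 : ℝ) ^ (-k) := by
    have h1 : δ = (c₁ * (2 : ℝ) ^ (-k)) ^ r := by
      rw [hδ, hX, hX₀, hE, Real.mul_rpow hc₁.le h2k.le, Real.inv_rpow hc₁.le,
        ← Real.rpow_intCast, ← Real.rpow_mul two_pos.le, Int.cast_neg, neg_mul,
        Real.rpow_neg two_pos.le]
      have := (Real.rpow_pos_of_pos hc₁ r).ne'
      have := (Real.rpow_pos_of_pos two_pos ((k : ℝ) * r)).ne'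
      field_simp
    rw [h1, ← Real.rpow_mul (by positivity), hr, one_div_mul_cancel hNd.ne', Real.rpow_one]
  have hlen : b - a ≤ c₂ * (2 : ℝ) ^ (-k) * 2 ^ y := by
    have h1 : b - a ≤ c₂ * 2 ^ Y := by
      rw [mul_comm]
      exact ((div_lt_iff₀ hc₂).1 hY).le
    have h2 : (2 : ℝ) ^ Y ≤ (2 : ℝ) ^ (-k) * 2 ^ y := by
      rw [← zpow_natCast, ← zpow_natCast, ← zpow_add₀ two_ne_zero]
      refine zpow_le_zpow_right₀ one_le_two ?_
      have := Int.self_le_toNat (k + Y)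
      omega
    rw [mul_assoc]
    exact h1.trans (mul_le_mul_of_nonneg_left h2 hc₂.le)
  obtain ⟨l, hl, hll, hl'⟩ := exists_isPartition_of_pieces (IsStable a b γ c k) (u₀ := a) (v := b)
    hδ0.le (A * (if d = 1 then 1 else y + 1)) (fun u w hu huw hw hwu => hA k y u w hu huw hw
      ((Real.rpow_le_rpow (by linarith) hwu hNd.le).trans hδ1) (by linarith)) M a le_rfl hab.le
    (by
      have h1 : X * δ = b - a := by
        rw [hδ]
        field_simp
      rw [← h1]
      exact mul_le_mul_of_nonneg_right (Nat.lt_floor_add_one X).le hδ0.le)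
  refine ⟨l, hl, ?_, hl'⟩
  have hME : (M : ℝ) + 1 ≤ (X₀ + (2 : ℝ) ^ (Cγ * r)) * E := by
    have h1 : (M : ℝ) ≤ X := Nat.floor_le hX0.le
    -- The extra piece from rounding is absorbed because $k+C_\gamma$ is nonnegative.
    have h2 : 1 ≤ (2 : ℝ) ^ (Cγ * r) * E := by
      rw [hE, ← Real.rpow_add two_pos, ← add_mul]
      exact Real.one_le_rpow one_le_two (mul_nonneg (by linarith) hr0.le)
    rw [add_mul]
    linarith
  have hfac : ((if d = 1 then 1 else y + 1 : ℕ) : ℝ) ≤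
      (Y + 2) * (if d = 1 then 1 else (k : ℝ) + Cγ) := by
    have hY0 : (0 : ℝ) ≤ Y := Nat.cast_nonneg Y
    split_ifs
    · push_cast
      linarith
    · have h1 : (y : ℝ) ≤ (k : ℝ) + Cγ + Y := by
        rcases le_or_gt 0 (k + Y) with h | h
        · have h2 : ((y : ℤ) : ℝ) = ((k + Y : ℤ) : ℝ) := by
            rw [hy, Int.toNat_of_nonneg h]
          push_cast at h2
          linarith
        · rw [hy, Int.toNat_of_nonpos h.le]
          push_cast
          linarith
      push_cast
      nlinarith
  calc (l.length : ℝ) ≤ ((M + 1) * (A * (if d = 1 then 1 else y + 1 : ℕ)) : ℕ) := by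
        exact_mod_cast hll
    _ = ((M : ℝ) + 1) * (A * ((if d = 1 then 1 else y + 1 : ℕ) : ℝ)) := by push_cast; rfl
    _ ≤ ((X₀ + (2 : ℝ) ^ (Cγ * r)) * E) *
        ((A + 1) * ((Y + 2) * (if d = 1 then 1 else (k : ℝ) + Cγ))) := by
        refine mul_le_mul hME (mul_le_mul (by linarith) hfac (by positivity) (by positivity))
          (by positivity) (by positivity)
    _ = (X₀ + (2 : ℝ) ^ (Cγ * r)) * (A + 1) * (Y + 2) *
        ((if d = 1 then 1 else (k : ℝ) + Cγ) * E) := by ring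
    _ ≤ (X₀ + (2 : ℝ) ^ (Cγ * r)) * (A + 1) * (Y + 2) *
        (C₀ * (2 : ℝ) ^ ((k : ℝ) * decompositionExponent d N)) :=
        mul_le_mul_of_nonneg_left (hC₀' k hk) (by positivity)
    _ = _ := by ring

/-- A quarter of relative error leaves the factors $\frac34\cdot\frac12\ge\frac14$ and
$\frac54\le2$, which are the constants of both decompositions. -/
theorem quarter_bounds {x y : ℝ} {k : ℤ} (h1 : (2 : ℝ) ^ (-k - 1) ≤ |x|)
    (h2 : |x| ≤ (2 : ℝ) ^ (-k)) (h : |y - x| ≤ 1 / 4 * |x|) :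
    1 / 4 * (2 : ℝ) ^ (-k) ≤ |y| ∧ |y| ≤ 2 * (2 : ℝ) ^ (-k) := by
  have h3 := abs_sub_abs_le_abs_sub y x
  have h4 := abs_sub_abs_le_abs_sub x y
  rw [abs_sub_comm x y] at h4
  rw [zpow_sub_one₀ two_ne_zero] at h1
  constructor <;> linarith

/-- The family of stable intervals that covers a level set of the torsion. -/
theorem IsCurveOfClass.exists_family (hd : 1 ≤ d) (hab : a < b) (hN : (d : ℝ) < N)
    (hγ : IsCurveOfClass N a b γ) :
    ∃ C : ℝ, 0 < C ∧ ∀ kd : ℤ, (torsionLevel a b γ kd).Nonempty →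
      1 ≤ (kd : ℝ) + (|Real.logb 2 (d.factorial * curveNorm a b γ ^ d)| + 2) ∧
      ∃ (n : ℕ) (lo hi : Fin n → ℝ) (σ : Fin n → Equiv.Perm (Fin d)) (k : Fin n → ℕ → ℤ),
        (∀ l, a ≤ lo l ∧ lo l ≤ hi l ∧ hi l ≤ b) ∧
        torsionLevel a b γ kd ⊆ ⋃ l, Icc (lo l) (hi l) ∧
        (∀ l, k l d = kd) ∧
        (∀ l, ∀ j : ℕ, j ≤ d →
          -1 - Real.logb 2 (j.factorial * curveNorm a b γ ^ j) ≤ (k l j : ℝ) ∧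
          (k l j : ℝ) ≤ kd + (-1 - Real.logb 2 (j.factorial * curveNorm a b γ ^ j)) +
            Real.logb 2 ((d.factorial : ℝ) * curveNorm a b γ ^ d) + 2) ∧
        (∀ l, ∀ j : ℕ, 1 ≤ j → ∀ hj : j ≤ d, ∃ x : ℝ,
          (2 : ℝ) ^ (-k l j - 1) ≤ |x| ∧ |x| ≤ (2 : ℝ) ^ (-k l j) ∧
          ∀ s : Fin j → ℝ, (∀ q, s q ∈ Icc (lo l) (hi l)) →
            |vectorMinor (σ l) hj (fun q => curveDeriv a b γ (q + 1) (s q)) - x| ≤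
              1 / 4 * |x|) ∧
        (n : ℝ) ≤ C * (2 : ℝ) ^ ((kd : ℝ) * decompositionExponent d N) ∧
        ∑ l, (hi l - lo l) ≤ b - a := by
  classical
  have hdn : d ≤ ⌊N⌋₊ := Nat.le_floor hN.le
  have hγd : ContDiffOn ℝ d γ (Icc a b) := hγ.1.of_le (by exact_mod_cast hdn)
  set G := curveNorm a b γ with hG
  have hGle : ∀ t ∈ Icc a b, ∀ q ≤ d, ‖curveDeriv a b γ q t‖ ≤ G := fun t ht q hq =>
    norm_curveDeriv_le_curveNorm hab hγd hq ht
  have hG0 : 0 ≤ G := (norm_nonneg _).trans (hGle a ⟨le_rfl, hab.le⟩ 0 (Nat.zero_le _))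
  set c : ℝ := 1 / (2 * (d.factorial * (1 + G) ^ d)) with hc
  have hc0 : 0 < c := by positivity
  set Cγ : ℝ := |Real.logb 2 (d.factorial * G ^ d)| + 2 with hCγ
  obtain ⟨C, hC0, hC⟩ := hγ.exists_isPartition hd hab hN hc0 (Cγ := Cγ) (by positivity)
  refine ⟨C, hC0, fun kd ⟨t₀, ht₀⟩ => ?_⟩
  have hpow0 : (0 : ℝ) < (2 : ℝ) ^ (-kd - 1) := by positivity
  have hup := ht₀.2.1.trans (abs_torsionMinor_le (hGle t₀ ht₀.1) 1 le_rfl)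
  have hGpos : 0 < G := by
    rcases hG0.eq_or_lt with h | h
    · rw [← h, zero_pow (by omega), mul_zero] at hup
      linarith
    · exact h
  -- At a point of the level set, $2^{-k_d-1}\le d!\,G^d$, so $k_d$ is bounded below in terms of the
  -- norm alone.
  have hk1 : 1 ≤ (kd : ℝ) + Cγ := by
    have h1 : -(kd : ℝ) - 1 ≤ Real.logb 2 (d.factorial * G ^ d) := by
      rw [Real.le_logb_iff_rpow_le one_lt_two (by positivity)]
      rw [← Real.rpow_intCast] at hup
      push_cast at hup
      exact hup
    have h2 := le_abs_self (Real.logb 2 (d.factorial * G ^ d))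
    rw [hCγ]
    linarith
  refine ⟨hk1, ?_⟩
  obtain ⟨l, hl, hlen, hst⟩ := hC kd hk1
  set P : ℝ × ℝ → Prop := fun I => ∃ t ∈ Icc I.1 I.2, t ∈ torsionLevel a b γ kd with hP
  -- Only intervals that meet the level set are kept; each then contains a point at which a
  -- permutation can be chosen and stability applied.
  set l' := l.filter fun I => decide (P I) with hl'
  have hmem : ∀ I ∈ l', I ∈ l ∧ P I := fun I hI => by simpa [hl'] using hI
  have hget : ∀ i : Fin l'.length, l'[i] ∈ l ∧ P l'[i] := fun i => hmem _ (List.getElem_mem _)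
  have hpt : ∀ i : Fin l'.length, ∃ (σ : Equiv.Perm (Fin d)) (k : ℕ → ℤ), k d = kd ∧
      (∀ j : ℕ, j ≤ d →
          -1 - Real.logb 2 (j.factorial * G ^ j) ≤ (k j : ℝ) ∧
          (k j : ℝ) ≤ kd + (-1 - Real.logb 2 (j.factorial * G ^ j)) +
            Real.logb 2 ((d.factorial : ℝ) * G ^ d) + 2) ∧
      (∀ j : ℕ, 1 ≤ j → ∀ hj : j ≤ d, ∃ x : ℝ,
          (2 : ℝ) ^ (-k j - 1) ≤ |x| ∧ |x| ≤ (2 : ℝ) ^ (-k j) ∧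
          ∀ s : Fin j → ℝ, (∀ q, s q ∈ Icc l'[i].1 l'[i].2) →
            |vectorMinor σ hj (fun q => curveDeriv a b γ (q + 1) (s q)) - x| ≤
              1 / 4 * |x|) := by
    intro i
    obtain ⟨hil, t, htI, htE⟩ := hget i
    obtain ⟨σ, k, hkd, hk⟩ := exists_perm_torsionMinor hGpos (hGle t htE.1) kd htE.2.1 htE.2.2
    refine ⟨σ, k, hkd, fun j hj => ⟨(hk j hj).2.2.2.1, (hk j hj).2.2.2.2⟩, fun j hj1 hj => ?_⟩
    refine ⟨curveMinor a b γ σ j hj t, (hk j hj).1, (hk j hj).2.1, ?_⟩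
    refine hst _ hil σ t htI (fun j hj1 hj => ?_) ?_ j hj1 hj
    · have h1 := (hk j hj).2.2.1
      rw [zpow_sub_one₀ two_ne_zero] at h1
      rw [hc, one_div_mul_eq_div, div_le_iff₀ (by positivity)]
      change _ ≤ |torsionMinor _ σ j hj| * _
      linarith
    · have h1 := (hk d le_rfl).2.1
      rwa [hkd] at h1
  choose σ k hkd hkA hkx using hpt
  refine ⟨l'.length, fun i => l'[i].1, fun i => l'[i].2, σ, k, fun i => hl.mem _ (hget i).1, ?_,
    hkd, hkA, hkx, ?_, ?_⟩
  · intro t ht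
    obtain ⟨I, hI, htI⟩ := hl.cover t ht.1
    have hI' : I ∈ l' := by
      rw [hl', List.mem_filter]
      exact ⟨hI, by simpa [hP] using ⟨t, htI, ht⟩⟩
    obtain ⟨i, hi, rfl⟩ := List.mem_iff_getElem.1 hI'
    exact mem_iUnion.2 ⟨⟨i, hi⟩, htI⟩
  · refine le_trans ?_ hlen
    exact_mod_cast List.length_filter_le _ _
  · have h1 := Fin.sum_univ_fun_getElem l' fun I => I.2 - I.1
    refine h1.le.trans ?_
    rw [← hl.length_sum]
    refine List.Sublist.sum_le_sum (List.filter_sublist.map _) fun x hx => ?_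
    obtain ⟨I, hI, rfl⟩ := List.mem_map.1 hx
    have := hl.mem I hI
    linarith [this.2.1]

end TorsionDecomposition

end

/-! ### The two decompositions -/

theorem proposition3p1 (d : ℕ) (hd : 1 ≤ d) (a b : ℝ) (hab : a < b) :
    -- the constants `c₁`, `c₂`, `C` depend only on the dimension and the interval
    ∃ c₁ c₂ C : ℝ, 0 < c₁ ∧ 0 < c₂ ∧ 0 < C ∧
    ∀ γ : ℝ → EuclideanSpace ℝ (Fin d),
    -- the constants `Cγ` and `A j` depend also on the curve
    ∃ (Cγ : ℝ) (A : ℕ → ℝ), 0 < Cγ ∧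
    ∀ N : ℝ, (d : ℝ) < N → TorsionDecomposition.IsCurveOfClass N a b γ →
    -- the constant `CNγ` depends also on the smoothness
    ∃ CNγ : ℝ, 0 < CNγ ∧
    ∀ kd : ℤ,
      -- the initial decomposition, for the curve itself
      (∃ (n : ℕ) (lo hi : Fin n → ℝ) (σ : Fin n → Equiv.Perm (Fin d)) (k : Fin n → ℕ → ℤ),
        (∀ l, a ≤ lo l ∧ lo l ≤ hi l ∧ hi l ≤ b) ∧
        TorsionDecomposition.torsionLevel a b γ kd ⊆ ⋃ l, Set.Icc (lo l) (hi l) ∧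
        (∀ l, k l d = kd) ∧
        (∀ l, ∀ j : ℕ, 1 ≤ j → j ≤ d →
          A j ≤ (k l j : ℝ) ∧
          (k l j : ℝ) ≤ kd + A j +
            Real.logb 2 ((d.factorial : ℝ) * TorsionDecomposition.curveNorm a b γ ^ d) + 2) ∧
        (∀ l, ∀ j : ℕ, 1 ≤ j → ∀ hj : j ≤ d, ∀ t ∈ Set.Icc (lo l) (hi l),
          (2 : ℝ) ^ (-(k l j) - 2) ≤
              |TorsionDecomposition.curveMinor a b γ (σ l) j hj t| ∧
            |TorsionDecomposition.curveMinor a b γ (σ l) j hj t| ≤ (2 : ℝ) ^ (-(k l j) + 1)) ∧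
        (n : ℝ) ≤ CNγ * (2 : ℝ) ^ ((kd : ℝ) * TorsionDecomposition.decompositionExponent d N) ∧
        ∑ l, (hi l - lo l) ≤ C * (max ((kd : ℝ) + Cγ) 0) ^ d) ∧
      -- the full decomposition, for all offspring curves
      (∃ (n : ℕ) (lo hi : Fin n → ℝ) (σ : Fin n → Equiv.Perm (Fin d)) (k : Fin n → ℕ → ℤ),
        (∀ l, a ≤ lo l ∧ lo l ≤ hi l ∧ hi l ≤ b) ∧
        TorsionDecomposition.torsionLevel a b γ kd ⊆ ⋃ l, Set.Icc (lo l) (hi l) ∧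
        (∀ l, k l d = kd) ∧
        (∀ (m : ℕ), 1 ≤ m → ∀ (h : Fin m → ℝ), ∀ l, ∀ j : ℕ, 1 ≤ j → ∀ hj : j ≤ d,
          ∀ t ∈ TorsionDecomposition.shifted (Set.Icc (lo l) (hi l)) h,
          c₁ * (2 : ℝ) ^ (-(k l j)) ≤
              |TorsionDecomposition.offspringMinor a b γ h (σ l) j hj t| ∧
            |TorsionDecomposition.offspringMinor a b γ h (σ l) j hj t| ≤
              c₂ * (2 : ℝ) ^ (-(k l j))) ∧
        (n : ℝ) ≤ CNγ * (max ((kd : ℝ) + Cγ) 0) ^ d *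
          (2 : ℝ) ^ ((kd : ℝ) * TorsionDecomposition.decompositionExponent d N) ∧
        ∑ l, (hi l - lo l) ≤ C * (max ((kd : ℝ) + Cγ) 0) ^ d) := by
  have hba : 0 < b - a := by linarith
  refine ⟨1 / 4, 2, b - a, by norm_num, by norm_num, hba, fun γ => ?_⟩
  -- These values are fixed before `N`. If the norm is $0$ the logarithms take default values,
  -- harmlessly: for a curve of class $C^N$ the level sets are then empty.
  refine ⟨|Real.logb 2 (d.factorial * TorsionDecomposition.curveNorm a b γ ^ d)| + 2,
    fun j => -1 - Real.logb 2 (j.factorial * TorsionDecomposition.curveNorm a b γ ^ j),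
    by positivity, fun N hN hγ => ?_⟩
  obtain ⟨C, hC0, hC⟩ := hγ.exists_family hd hab hN
  refine ⟨C, hC0, fun kd => ?_⟩
  rcases Set.eq_empty_or_nonempty (TorsionDecomposition.torsionLevel a b γ kd) with hE | hE
  · rw [hE]
    refine ⟨⟨0, Fin.elim0, Fin.elim0, Fin.elim0, Fin.elim0, fun l => l.elim0, by simp,
      fun l => l.elim0, fun l => l.elim0, fun l => l.elim0, ?_, ?_⟩,
      ⟨0, Fin.elim0, Fin.elim0, Fin.elim0, Fin.elim0, fun l => l.elim0, by simp,
      fun l => l.elim0, fun _ _ _ l => l.elim0, ?_, ?_⟩⟩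
    · push_cast
      positivity
    · rw [Finset.univ_eq_empty, Finset.sum_empty]
      positivity
    · push_cast
      positivity
    · rw [Finset.univ_eq_empty, Finset.sum_empty]
      positivity
  obtain ⟨hk1, n, lo, hi, σ, k, hI, hcov, hkd, hkA, hkx, hn, hsum⟩ := hC kd hE
  set y : ℝ := max ((kd : ℝ) +
    (|Real.logb 2 (d.factorial * TorsionDecomposition.curveNorm a b γ ^ d)| + 2)) 0
  -- One family satisfies both statements with sharper bounds than required; the factor
  -- $(k_d+C_\gamma)_+^d$ only has to be at least $1$.
  have hpow : 1 ≤ y ^ d := one_le_pow₀ (hk1.trans (le_max_left _ _))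
  have hsum' : ∑ l, (hi l - lo l) ≤ (b - a) * y ^ d :=
    hsum.trans (le_mul_of_one_le_right hba.le hpow)
  refine ⟨⟨n, lo, hi, σ, k, hI, hcov, hkd, fun l j _ hj => hkA l j hj, ?_, hn, hsum'⟩,
    ⟨n, lo, hi, σ, k, hI, hcov, hkd, ?_, ?_, hsum'⟩⟩
  · intro l j hj1 hj t ht
    obtain ⟨x, hx1, hx2, hx⟩ := hkx l j hj1 hj
    have h1 := TorsionDecomposition.quarter_bounds hx1 hx2 (hx (fun _ => t) fun _ => ht)
    rw [← TorsionDecomposition.torsionMinor_eq_vectorMinor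
      (fun i => TorsionDecomposition.curveDeriv a b γ i t)] at h1
    rw [zpow_sub₀ two_ne_zero, zpow_add₀ two_ne_zero]
    norm_num1
    constructor
    · refine le_trans (le_of_eq ?_) h1.1
      norm_num
      ring
    · refine h1.2.trans (le_of_eq ?_)
      norm_num
      ring
  · intro m hm h l j hj1 hj t ht
    obtain ⟨x, hx1, hx2, hx⟩ := hkx l j hj1 hj
    -- Row `q` of the offspring minor averages over the points `t + h p`, all in the stable interval
    -- by the definition of `shifted`; each choice `r` gives one mixed minor.
    have h1 := TorsionDecomposition.abs_vectorMinor_average_sub_le hm (σ l) hj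
      (fun q p => TorsionDecomposition.curveDeriv a b γ (q + 1) (t + h p))
      fun r => hx (fun q => t + h (r q)) fun q => ht (r q)
    have h2 := TorsionDecomposition.quarter_bounds hx1 hx2 h1
    rwa [TorsionDecomposition.offspringMinor, TorsionDecomposition.torsionMinor_eq_vectorMinor]
  · refine hn.trans (mul_le_mul_of_nonneg_right ?_ (by positivity))
    exact le_mul_of_one_le_right hC0.le hpow
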